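/- Let $\mathfrak h,\mathfrak h',\mathsf k$ be complex Hilbert spaces (inner products linear in the second argument), let $V\subset B(\mathfrak h;\mathfrak h')$ be a concrete operator space (a norm-closed subspace), and let $D,D'$ be dense subspaces of $\mathsf k$. Let $\mathcal F$ be the symmetric Fock space over $L^2(\mathbb R_+;\mathsf k)$ with exponential vectors $\varepsilon(g)=((n!)^{-1/2}g^{\otimes n})_{n\ge0}$. Let $\mathbb S_D=\mathrm{Lin}\{d_{[0,t[}:d\in D,\,t\ge0\}$ be the space of right-continuous $D$-valued step functions, let $\mathbb S=\mathbb S_{\mathsf k}$ be the space of all $\mathsf k$-valued ones, let $\mathcal E_D=\mathrm{Lin}\{\varepsilon(g):g\in\mathbb S_D\}$, and let $\mathcal D=\mathfrak h\,\underline\otimes\,\mathcal E_D$, $\mathcal D'=\mathfrak h'\,\underline\otimes\,\mathcal E_{D'}$ (algebraic tensor products). For $c\in\mathsf k$ put $\hat c=\binom1c\in\mathbb C\oplus\mathsf k$, let $\hat D=\mathrm{Lin}\{\hat c:c\in D\}$, and put $\hat g(s)=\widehat{g(s)}$. Write $g_I$ for the function which agrees with $g$ on $I$ and vanishes off $I$,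 and $v\varepsilon(g)$ for $v\otimes\varepsilon(g)$. Let $k=(k_t)_{t\ge0}$ be a linear process on $V$. That is, each $k_t(x)$ ($x\in V$) is a linear operator from $\mathcal D$ to $\mathfrak h'\otimes\mathcal F$, depending linearly on $x$; each map $t\mapsto\langle\xi',k_t(x)\xi\rangle$ ($\xi'\in\mathfrak h'\otimes\mathcal F$, $\xi\in\mathcal D$) is measurable; the process is adapted, i.e. $$\langle u'\varepsilon(g'),k_t(x)u\varepsilon(g)\rangle=\langle u'\varepsilon(g'_{[0,t[}),k_t(x)u\varepsilon(g_{[0,t[})\rangle\,\langle\varepsilon(g'_{[t,\infty[}),\varepsilon(g_{[t,\infty[})\rangle$$ for $u\in\mathfrak h$, $u'\in\mathfrak h'$, $g\in\mathbb S_D$, $g'\in\mathbb S$; and the operators $(I\otimes\langle e'|)\,k_t(x)\,(I\otimes|e\rangle)$ belong to $V$ for all $e'\in\mathcal E_{D'}$, $e\in\mathcal E_D$. For $g'\in\mathbb S_{D'}$ and $g\in\mathbb S_D$ define $k^{g',g}_t:V\to V$ by $$k^{g',g}_t(x)=e^{-\langle g'_{[0,t[},g_{[0,t[}\rangle}\,(I\otimes\langle\varepsilon(g'_{[0,t[})|)\,k_t(x)\,(I\otimes|\varepsilon(g_{[0,t[})\rangle),$$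 and for $c'\in D'$, $c\in D$ define $P^{c',c}_t=k_t^{c'_{[0,t[},\,c_{[0,t[}}$. Assume the following. 1. $k$ is a weak quantum stochastic cocycle: $k^{g',g}_0=\mathrm{id}_V$ and $k^{g',g}_{r+t}=k^{g',g}_r\circ k^{S_r^*g',S_r^*g}_t$ for all $r,t\ge0$, $g'\in\mathbb S_{D'}$, $g\in\mathbb S_D$, where $(S_r^*g)(s)=g(s+r)$. In particular each $P^{c',c}$ is a one-parameter semigroup. 2. $k$ has a conjugate process: $\mathcal D'\subset\mathrm{Dom}\,k_t(x)^*$ for all $x\in V$ and $t\ge 0$. 3. $k$ is Markov-regular: each $k^{g',g}_t$ is bounded and each semigroup $P^{c',c}$ is norm continuous $\mathbb R_+\to B(V)$. 4. For all $x\in V$, $\xi\in\mathcal D$ and $\xi'\in\mathcal D'$, the maps $t\mapsto k_t(x)\xi$ and $t\mapsto k_t(x)^*\xi'$ are continuous at $0$. Then there is a sesquilinear map $\phi:\hat D'\times\hat D\to B(V)$, $(\zeta',\zeta)\mapsto\phi^{\zeta'}_\zeta$, such that $\phi^{\hat c'}_{\hat c}$ is the generator of $P^{c',c}$, that is, $\phi^{\hat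 c'}_{\hat c}=\lim_{t\to0^+}t^{-1}(P^{c',c}_t-\mathrm{id}_V)$ in norm, for all $c'\in D'$ and $c\in D$, and such that $k$ is a $(\mathcal D',\mathcal D)$-weak solution of the quantum stochastic differential equation $$dk_t=k_t\bullet d\Lambda_\phi(t),\qquad k_0=\iota .$$ That is, $t\mapsto\langle\xi',k_t(x)\xi\rangle$ is continuous for all $x\in V$, $\xi'\in\mathcal D'$, $\xi\in\mathcal D$, and $$\langle v'\varepsilon(g'),k_t(x)v\varepsilon(g)\rangle-\langle v',xv\rangle\langle\varepsilon(g'),\varepsilon(g)\rangle=\int_0^t\Big\langle v'\varepsilon(g'),k_s\big(\phi^{\hat g'(s)}_{\hat g(s)}(x)\big)v\varepsilon(g)\Big\rangle\,ds,$$ with integrable integrand, for all $x\in V$, $v\in\mathfrak h$, $v'\in\mathfrak h'$, $g\in\mathbb S_D$, $g'\in\mathbb S_{D'}$ and $t\ge0$. -/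

import Mathlib

open MeasureTheory Filter Topology
open scoped NNReal ENNReal TensorProduct ComplexConjugate

noncomputable section

namespace QS

universe u v w

/-! ### Hilbert space tensor products and the symmetric Fock space -/

/-- The Hilbert space tensor product: the completion of the algebraic tensor product. -/
def HTensor (E : Type u) (F : Type v) [NormedAddCommGroup E] [InnerProductSpace ℂ E]
    [NormedAddCommGroup F] [InnerProductSpace ℂ F] : Type (max u v) :=
  UniformSpace.Completion (E ⊗[ℂ] F)

section HTensorInstances

variable (E : Type u) (F : Type v) [NormedAddCommGroup E] [InnerProductSpace ℂ E]
  [NormedAddCommGroup F] [InnerProductSpace ℂ F]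

instance : NormedAddCommGroup (HTensor E F) :=
  inferInstanceAs (NormedAddCommGroup (UniformSpace.Completion (E ⊗[ℂ] F)))

instance : InnerProductSpace ℂ (HTensor E F) :=
  inferInstanceAs (InnerProductSpace ℂ (UniformSpace.Completion (E ⊗[ℂ] F)))

instance : CompleteSpace (HTensor E F) :=
  inferInstanceAs (CompleteSpace (UniformSpace.Completion (E ⊗[ℂ] F)))

end HTensorInstances

/-- `ket e` is the operator `E_e : u ↦ u ⊗ e` from `E` to `E ⊗ F`. -/
def ket {E : Type u} {F : Type v} [NormedAddCommGroup E] [InnerProductSpace ℂ E]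
    [NormedAddCommGroup F] [InnerProductSpace ℂ F] (e : F) : E →L[ℂ] HTensor E F :=
  (UniformSpace.Completion.toComplL (𝕜 := ℂ) (E := E ⊗[ℂ] F)).comp
    ((TensorProduct.mkL ℂ E F).flip e)

/-- `bra e` is the operator `E^e = I ⊗ ⟨e|` from `E ⊗ F` to `E`, the adjoint of `ket e`. -/
def bra {E : Type u} {F : Type v} [NormedAddCommGroup E] [InnerProductSpace ℂ E]
    [CompleteSpace E] [NormedAddCommGroup F] [InnerProductSpace ℂ F] (e : F) :
    HTensor E F →L[ℂ] E :=
  ContinuousLinearMap.adjoint (ket (E := E) e)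

/-- A complex Hilbert space, bundled so that tensor powers can be defined by recursion. -/
structure HilbSp : Type (u + 1) where
  carrier : Type u
  [grp : NormedAddCommGroup carrier]
  [ips : InnerProductSpace ℂ carrier]
  [cpl : CompleteSpace carrier]

attribute [instance] HilbSp.grp HilbSp.ips HilbSp.cpl

/-- The `n`-fold Hilbert space tensor power of `H`; the zeroth power is the one-dimensional
space `ℂ` (written as functions on a point, to live in the universe of `H`). -/
def tpow (H : Type u) [NormedAddCommGroup H] [InnerProductSpace ℂ H] : ℕ → HilbSp.{u}
  | 0 => ⟨EuclideanSpace ℂ PUnit.{u + 1}⟩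
  | n + 1 => ⟨HTensor H (tpow H n).carrier⟩

/-- The vector `f ⊗ ⋯ ⊗ f` in the `n`-th tensor power. -/
def powVec {H : Type u} [NormedAddCommGroup H] [InnerProductSpace ℂ H] (f : H) :
    (n : ℕ) → (tpow H n).carrier
  | 0 => EuclideanSpace.single (PUnit.unit : PUnit.{u + 1}) (1 : ℂ)
  | n + 1 => ket (powVec f n) f

/-- The symmetric `n`-th tensor power: the closed linear span of the vectors `f ⊗ ⋯ ⊗ f`. -/
def symPow (H : Type u) [NormedAddCommGroup H] [InnerProductSpace ℂ H] (n : ℕ) :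
    Submodule ℂ (tpow H n).carrier :=
  (Submodule.span ℂ (Set.range fun f : H => powVec f n)).topologicalClosure

/-- The symmetric Fock space over `H`: the Hilbert space direct sum of the symmetric powers. -/
def Fock (H : Type u) [NormedAddCommGroup H] [InnerProductSpace ℂ H] : Type u :=
  lp (fun n : ℕ => symPow H n) 2

instance symPow_complete (H : Type u) [NormedAddCommGroup H] [InnerProductSpace ℂ H] (n : ℕ) :
    CompleteSpace (symPow H n) :=
  (Submodule.isClosed_topologicalClosure _).completeSpace_coe

section FockInstances

variable (H : Type u) [NormedAddCommGroup H] [InnerProductSpace ℂ H]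

instance : NormedAddCommGroup (Fock H) :=
  inferInstanceAs (NormedAddCommGroup (lp (fun n : ℕ => symPow H n) 2))

instance : InnerProductSpace ℂ (Fock H) :=
  inferInstanceAs (InnerProductSpace ℂ (lp (fun n : ℕ => symPow H n) 2))

instance : CompleteSpace (Fock H) :=
  inferInstanceAs (CompleteSpace (lp (fun n : ℕ => symPow H n) 2))

end FockInstances

/-- `f ⊗ ⋯ ⊗ f` as an element of the symmetric power. -/
def symVec {H : Type u} [NormedAddCommGroup H] [InnerProductSpace ℂ H] (f : H) (n : ℕ) :
    symPow H n :=
  ⟨powVec f n, Submodule.le_topologicalClosure _ (Submodule.subset_span ⟨f, rfl⟩)⟩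

theorem norm_powVec {H : Type u} [NormedAddCommGroup H] [InnerProductSpace ℂ H] (f : H) (n : ℕ) :
    ‖powVec f n‖ = ‖f‖ ^ n := by
  induction n with
  | zero =>
    rw [pow_zero]
    change ‖EuclideanSpace.single (PUnit.unit : PUnit.{u + 1}) (1 : ℂ)‖ = 1
    simp
  | succ n ih =>
    change ‖((f ⊗ₜ[ℂ] powVec f n : H ⊗[ℂ] (tpow H n).carrier) :
      UniformSpace.Completion (H ⊗[ℂ] (tpow H n).carrier))‖ = _
    rw [UniformSpace.Completion.norm_coe, TensorProduct.norm_tmul, ih, pow_succ']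

/-- The exponential vector `ε(f) = ((n!)^{-1/2} f^{⊗ n})_n`. -/
def expVec {H : Type u} [NormedAddCommGroup H] [InnerProductSpace ℂ H] (f : H) : Fock H :=
  ⟨fun n => ((Real.sqrt (n.factorial : ℝ))⁻¹ : ℂ) • symVec f n, by
    refine memℓp_gen ?_
    have h : (fun n : ℕ => ‖((Real.sqrt (n.factorial : ℝ))⁻¹ : ℂ) • symVec f n‖ ^ (2 : ℝ≥0∞).toReal) =
        fun n : ℕ => (‖f‖ ^ 2) ^ n / (n.factorial : ℝ) := by
      funext n
      have h1 : ‖symVec f n‖ = ‖f‖ ^ n := norm_powVec f n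
      have h2 : Real.sqrt (n.factorial : ℝ) ^ 2 = (n.factorial : ℝ) := Real.sq_sqrt (by positivity)
      rw [norm_smul, h1, norm_inv, Complex.norm_real, Real.norm_eq_abs,
        abs_of_nonneg (Real.sqrt_nonneg _)]
      simp only [ENNReal.toReal_ofNat, Real.rpow_ofNat]
      rw [mul_pow, inv_pow, h2]
      ring
    rw [h]
    exact Real.summable_pow_div_factorial _⟩

/-! ### Step functions on the half-line -/

/-- Lebesgue measure on the half-line `ℝ≥0`. -/
def leb : Measure ℝ≥0 := Measure.comap ((↑) : ℝ≥0 → ℝ) volume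

theorem leb_Iio (t : ℝ≥0) : leb (Set.Iio t) = t := by
  have hm : MeasurableEmbedding ((↑) : ℝ≥0 → ℝ) :=
    MeasurableEmbedding.subtype_coe measurableSet_Ici
  have h : ((↑) : ℝ≥0 → ℝ) '' Set.Iio t = Set.Ico (0 : ℝ) t := by
    ext x
    constructor
    · rintro ⟨y, hy, rfl⟩
      exact ⟨y.2, by exact_mod_cast hy⟩
    · rintro ⟨h0, h1⟩
      exact ⟨⟨x, h0⟩, by exact_mod_cast h1, rfl⟩
  rw [leb, hm.comap_apply, h, Real.volume_Ico, sub_zero, ENNReal.ofReal_coe_nnreal]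

section Noise

variable {K : Type w} [NormedAddCommGroup K] [InnerProductSpace ℂ K]

/-- The right-continuous step functions with values in `D`: the linear span of the functions
`d_{[0,t[}` with `d ∈ D`, as genuine functions. -/
def Step (D : Submodule ℂ K) : Submodule ℂ (ℝ≥0 → K) :=
  Submodule.span ℂ {f | ∃ d ∈ D, ∃ t : ℝ≥0, f = (Set.Iio t).indicator fun _ => d}

/-- The function `d_{[0,t[}`. -/
def Step.const {D : Submodule ℂ K} (t : ℝ≥0) (d : D) : Step D :=
  ⟨(Set.Iio t).indicator fun _ => (d : K), Submodule.subset_span ⟨d, d.2, t, rfl⟩⟩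

theorem Step.apply_mem {D : Submodule ℂ K} (g : Step D) (s : ℝ≥0) : (g : ℝ≥0 → K) s ∈ D := by
  obtain ⟨g, hg⟩ := g
  change g s ∈ D
  induction hg using Submodule.span_induction with
  | mem f hf =>
    obtain ⟨d, hd, t, rfl⟩ := hf
    by_cases h : s ∈ Set.Iio t
    · simpa [Set.indicator_of_mem h] using hd
    · simp [Set.indicator_of_notMem h]
  | zero => exact D.zero_mem
  | add f g _ _ hf hg => exact D.add_mem hf hg
  | smul a f _ hf => exact D.smul_mem a hf

theorem Step.memLp {D : Submodule ℂ K} (g : Step D) : MemLp (g : ℝ≥0 → K) 2 leb := by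
  obtain ⟨g, hg⟩ := g
  change MemLp g 2 leb
  induction hg using Submodule.span_induction with
  | mem f hf =>
    obtain ⟨d, hd, t, rfl⟩ := hf
    exact memLp_indicator_const 2 measurableSet_Iio d (Or.inr (by simp [leb_Iio]))
  | zero => exact MemLp.zero
  | add f g _ _ hf hg => exact hf.add hg
  | smul a f _ hf => exact hf.const_smul a

/-- A step function as an element of `L²(ℝ₊; K)`. -/
def Step.toL2 {D : Submodule ℂ K} (g : Step D) : Lp K 2 leb := (Step.memLp g).toLp _

/-- The truncation `g_{[0,t[}`. -/
def Step.trunc {D : Submodule ℂ K} (t : ℝ≥0) (g : Step D) : Step D :=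
  ⟨(Set.Iio t).indicator (g : ℝ≥0 → K), by
    obtain ⟨g, hg⟩ := g
    change (Set.Iio t).indicator g ∈ Step D
    induction hg using Submodule.span_induction with
    | mem f hf =>
      obtain ⟨d, hd, s, rfl⟩ := hf
      rw [Set.indicator_indicator, Set.Iio_inter_Iio]
      exact Submodule.subset_span ⟨d, hd, _, rfl⟩
    | zero => simp
    | add f g _ _ hf hg =>
      rw [Set.indicator_add']
      exact Submodule.add_mem _ hf hg
    | smul a f _ hf =>
      have h : (Set.Iio t).indicator (a • f) = a • (Set.Iio t).indicator f := by
        funext x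
        by_cases hx : x ∈ Set.Iio t <;> simp [Set.indicator, hx]
      rw [h]
      exact Submodule.smul_mem _ a hf⟩

/-- The tail `g_{[t,∞[}`. -/
def Step.tail {D : Submodule ℂ K} (t : ℝ≥0) (g : Step D) : Step D := g - Step.trunc t g

/-- The adjoint `S_r^*` of the right shift, acting on step functions: `(S_r^* g)(s) = g(s + r)`. -/
def Step.shift {D : Submodule ℂ K} (r : ℝ≥0) (g : Step D) : Step D :=
  ⟨fun s => (g : ℝ≥0 → K) (s + r), by
    obtain ⟨g, hg⟩ := g
    change (fun s => g (s + r)) ∈ Step D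
    induction hg using Submodule.span_induction with
    | mem f hf =>
      obtain ⟨d, hd, t, rfl⟩ := hf
      refine Submodule.subset_span ⟨d, hd, t - r, ?_⟩
      funext s
      simp [Set.indicator, lt_tsub_iff_right]
    | zero => exact Submodule.zero_mem _
    | add f g _ _ hf hg => exact Submodule.add_mem _ hf hg
    | smul a f _ hf => exact Submodule.smul_mem _ a hf⟩

variable (K) in
/-- The symmetric Fock space over `L²(ℝ₊; K)`. -/
abbrev NoiseFock : Type w := Fock (Lp K 2 leb)

/-- The exponential vector of a step function. -/
def Step.exp {D : Submodule ℂ K} (g : Step D) : NoiseFock K := expVec (Step.toL2 g)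

/-- The linear span of the exponential vectors of `D`-valued step functions. -/
def Exps (D : Submodule ℂ K) : Submodule ℂ (NoiseFock K) :=
  Submodule.span ℂ (Set.range fun g : Step D => Step.exp g)

theorem Step.exp_mem {D : Submodule ℂ K} (g : Step D) : Step.exp g ∈ Exps D :=
  Submodule.subset_span ⟨g, rfl⟩

/-- The vector `(1, c)` in the Hilbert space `ℂ ⊕ K`. -/
def hat (c : K) : WithLp 2 (ℂ × K) := WithLp.toLp 2 (1, c)

/-- The linear span of the vectors `(1, c)` with `c ∈ D`. -/
def Hat (D : Submodule ℂ K) : Submodule ℂ (WithLp 2 (ℂ × K)) :=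
  Submodule.span ℂ (hat '' (D : Set K))

/-- The vector `(1, c)` as an element of `Hat D`. -/
def Hat.mk {D : Submodule ℂ K} (c : D) : Hat D :=
  ⟨hat (c : K), Submodule.subset_span ⟨c, c.2, rfl⟩⟩

/-- The value at `s` of the function associated with `g`: the vector `(1, g(s))`. -/
def Step.hatAt {D : Submodule ℂ K} (g : Step D) (s : ℝ≥0) : Hat D :=
  Hat.mk ⟨(g : ℝ≥0 → K) s, Step.apply_mem g s⟩

/-! ### Exponential domains and processes -/

variable {h : Type u} [NormedAddCommGroup h] [InnerProductSpace ℂ h]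
variable {h' : Type v} [NormedAddCommGroup h'] [InnerProductSpace ℂ h']

variable (h) in
/-- The exponential domain `h ⊙ Exps D` (algebraic tensor product) inside `h ⊗ Fock`. -/
def expDomain (D : Submodule ℂ K) : Submodule ℂ (HTensor h (NoiseFock K)) :=
  Submodule.span ℂ {ξ | ∃ (u : h), ∃ e ∈ Exps D, ξ = ket e u}

/-- `u ↦ u ⊗ e` as a map into the exponential domain, for `e ∈ Exps D`. -/
def ketD {D : Submodule ℂ K} (e : Exps D) : h →ₗ[ℂ] expDomain h D :=
  LinearMap.codRestrict _ (ket (E := h) (e : NoiseFock K)).toLinearMap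
    fun u => Submodule.subset_span ⟨u, e, e.2, rfl⟩

/-- The vector `u ε(g)` of the exponential domain. -/
def uExp {D : Submodule ℂ K} (u : h) (g : Step D) : expDomain h D :=
  ketD ⟨Step.exp g, Step.exp_mem g⟩ u

/-- The slice `ω_{e',e} • T = E^{e'} T E_e`, an operator from `h` to `h'`. -/
def slice [CompleteSpace h'] {D : Submodule ℂ K}
    (T : expDomain h D →ₗ[ℂ] HTensor h' (NoiseFock K)) (e' : NoiseFock K) (e : Exps D) :
    h →ₗ[ℂ] h' :=
  (bra e').toLinearMap ∘ₗ T ∘ₗ ketD e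

/-- The vector `ξ'` belongs to the domain of the adjoint `T^*`. -/
def InAdjointDomain {D : Submodule ℂ K} (T : expDomain h D →ₗ[ℂ] HTensor h' (NoiseFock K))
    (ξ' : HTensor h' (NoiseFock K)) : Prop :=
  ∃ η : HTensor h (NoiseFock K), ∀ ξ : expDomain h D,
    inner ℂ η (ξ : HTensor h (NoiseFock K)) = inner ℂ ξ' (T ξ)

/-- The vector `T^* ξ'` (which is unique since exponential domains are dense). -/
def adjointVec {D : Submodule ℂ K} (T : expDomain h D →ₗ[ℂ] HTensor h' (NoiseFock K))
    (ξ' : HTensor h' (NoiseFock K)) (hξ : InAdjointDomain T ξ') : HTensor h (NoiseFock K) :=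
  Classical.choose hξ

/-- A linear process on the concrete operator space `V ⊆ B(h; h')` whose slices by exponential
vectors map `V` into `V`: a family of operators `k_t(x)` with domain `h ⊙ Exps D`, linear in `x`,
that is weakly (Lebesgue) measurable and adapted. -/
structure Proc [CompleteSpace h'] (V : Submodule ℂ (h →L[ℂ] h')) (D D' : Submodule ℂ K) where
  toFun : ℝ≥0 → V →ₗ[ℂ] (expDomain h D →ₗ[ℂ] HTensor h' (NoiseFock K))
  weaklyMeasurable : ∀ (x : V) (ξ' : HTensor h' (NoiseFock K)) (ξ : expDomain h D),
    AEMeasurable (fun t => inner ℂ ξ' (toFun t x ξ)) leb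
  adapted : ∀ (x : V) (t : ℝ≥0) (u : h) (g : Step D) (u' : h') (g' : Step (⊤ : Submodule ℂ K)),
    inner ℂ (ket (Step.exp g') u') (toFun t x (uExp u g)) =
      inner ℂ (ket (Step.exp (Step.trunc t g')) u') (toFun t x (uExp u (Step.trunc t g))) *
        inner ℂ (Step.exp (Step.tail t g')) (Step.exp (Step.tail t g))
  slice_mem : ∀ (t : ℝ≥0) (x : V) (e' : Exps D') (e : Exps D),
    ∃ y : V, ∀ u : h, slice (toFun t x) e' e u = (y : h →L[ℂ] h') u

namespace Proc

variable [CompleteSpace h'] {V : Submodule ℂ (h →L[ℂ] h')} {D D' : Submodule ℂ K}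

/-- The map `ω_{e',e} • k_t : V → V`. -/
def sliceMap (k : Proc V D D') (t : ℝ≥0) (e' : Exps D') (e : Exps D) : V →ₗ[ℂ] V where
  toFun x := Classical.choose (k.slice_mem t x e' e)
  map_add' x y := by
    apply Subtype.ext
    ext u
    have h1 := Classical.choose_spec (k.slice_mem t (x + y) e' e) u
    have h2 := Classical.choose_spec (k.slice_mem t x e' e) u
    have h3 := Classical.choose_spec (k.slice_mem t y e' e) u
    rw [← h1, Submodule.coe_add, _root_.add_apply, ← h2, ← h3]
    simp [slice]
  map_smul' a x := by
    apply Subtype.ext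
    ext u
    have h1 := Classical.choose_spec (k.slice_mem t (a • x) e' e) u
    have h2 := Classical.choose_spec (k.slice_mem t x e' e) u
    rw [← h1, RingHom.id_apply, Submodule.coe_smul, _root_.smul_apply, ← h2]
    simp [slice]

/-- The map `k^{g',g}_t = exp(-⟨g'_{[0,t[}, g_{[0,t[}⟩) ω_{ε(g'_{[0,t[}), ε(g_{[0,t[})} • k_t`. -/
def form (k : Proc V D D') (g' : Step D') (g : Step D) (t : ℝ≥0) : V →ₗ[ℂ] V :=
  Complex.exp (-inner ℂ (Step.toL2 (Step.trunc t g')) (Step.toL2 (Step.trunc t g))) •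
    k.sliceMap t ⟨Step.exp (Step.trunc t g'), Step.exp_mem _⟩
      ⟨Step.exp (Step.trunc t g), Step.exp_mem _⟩

/-- A weak quantum stochastic cocycle: `k^{g',g}_{r+t} = k^{g',g}_r ∘ k^{S_r^* g', S_r^* g}_t`,
and `k^{g',g}_0` is the identity map (so that the associated semigroups are one-parameter
semigroups, starting at the identity). -/
structure IsCocycle (k : Proc V D D') : Prop where
  zero : ∀ (g' : Step D') (g : Step D), k.form g' g 0 = LinearMap.id
  add : ∀ (g' : Step D') (g : Step D) (r t : ℝ≥0),
    k.form g' g (r + t) = k.form g' g r ∘ₗ k.form (Step.shift r g') (Step.shift r g) t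

/-- Each `k_t(x)^*` is defined on the exponential domain `h' ⊙ Exps D'`: the process has a
conjugate process. -/
def HasConjugate (k : Proc V D D') : Prop :=
  ∀ (t : ℝ≥0) (x : V) (ξ' : expDomain h' D'), InAdjointDomain (k.toFun t x) ξ'

/-- All the maps `k^{g',g}_t` are bounded. -/
def InitialSpaceBounded (k : Proc V D D') : Prop :=
  ∀ (g' : Step D') (g : Step D) (t : ℝ≥0), Continuous (k.form g' g t)

/-- The associated semigroup `P^{c',c}_t = k^{c'_{[0,t[}, c_{[0,t[}}_t` in `B(V)`. -/
def assocSemigroup (k : Proc V D D') (hb : k.InitialSpaceBounded) (c' : D') (c : D) (t : ℝ≥0) :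
    V →L[ℂ] V :=
  ⟨k.form (Step.const t c') (Step.const t c) t, hb _ _ t⟩

/-- Markov-regularity: initial space bounded, with norm-continuous associated semigroups. -/
structure MarkovRegular (k : Proc V D D') : Prop where
  bounded : k.InitialSpaceBounded
  norm_continuous : ∀ (c' : D') (c : D), Continuous (k.assocSemigroup bounded c' c)

/-- `k` is a weak solution of `dk_t = k_t • dΛ_φ(t)`, `k_0 = ι ∘ κ`: it is pointwise weakly
continuous and satisfies the integral equation between vectors `v' ε(g')` and `v ε(g)`. -/
structure IsWeakSolution (k : Proc V D D')
    (φ : Hat D' →ₗ⋆[ℂ] Hat D →ₗ[ℂ] (V →L[ℂ] V)) (κ : V →ₗ[ℂ] (h →L[ℂ] h')) : Prop where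
  weaklyContinuous : ∀ (x : V) (ξ' : expDomain h' D') (ξ : expDomain h D),
    Continuous fun t : ℝ≥0 => inner ℂ (ξ' : HTensor h' (NoiseFock K)) (k.toFun t x ξ)
  integrable : ∀ (x : V) (v' : h') (g' : Step D') (v : h) (g : Step D) (t : ℝ≥0),
    IntervalIntegrable (fun s : ℝ => inner ℂ (uExp v' g' : HTensor h' (NoiseFock K))
      (k.toFun s.toNNReal (φ (Step.hatAt g' s.toNNReal) (Step.hatAt g s.toNNReal) x) (uExp v g)))
      volume 0 t
  eqn : ∀ (x : V) (v' : h') (g' : Step D') (v : h) (g : Step D) (t : ℝ≥0),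
    inner ℂ (uExp v' g' : HTensor h' (NoiseFock K)) (k.toFun t x (uExp v g)) -
        inner ℂ v' (κ x v) * inner ℂ (Step.exp g') (Step.exp g) =
      ∫ s in (0 : ℝ)..t, inner ℂ (uExp v' g' : HTensor h' (NoiseFock K))
        (k.toFun s.toNNReal (φ (Step.hatAt g' s.toNNReal) (Step.hatAt g s.toNNReal) x) (uExp v g))

end Proc

/-- `ψ` is the generator of the norm-continuous semigroup `P` of bounded operators:
`t⁻¹ (P_t - I) → ψ` in norm as `t → 0+`. -/
def IsGenerator {X : Type v} [NormedAddCommGroup X] [NormedSpace ℂ X] (P : ℝ≥0 → X →L[ℂ] X)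
    (ψ : X →L[ℂ] X) : Prop :=
  Tendsto (fun t : ℝ≥0 => ((t : ℝ)⁻¹ : ℂ) • (P t - ContinuousLinearMap.id ℂ X)) (𝓝[>] 0) (𝓝 ψ)

end Noise

end QS

end

namespace QS

/-! ### Inner products of simple tensors and of exponential vectors. -/

section InnerProducts

/-! Each `P^{c',c}` is a norm-continuous semigroup on the Banach space `V`, so it has a bounded
generator `G c' c`. Two things remain: `G` is affine in `c` and conjugate-affine in `c'`, which is
exactly what extends it to a sesquilinear map on `Hat D' × Hat D`; and the local generators yield
the integral equation.

Affinity is where continuity at `0` enters. If `∑ aᵢ = 0` and `∑ aᵢ cᵢ = 0`, then `w_t = ∑ aᵢ v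
ε((cᵢ)_{[0,t[})` has norm `O(t)`, because the constant and linear terms of `e^{t⟨cᵢ,cⱼ⟩}` cancel in
the Gram sum (`exists_norm_sum_uExp_const_le`). With `θ_t = k_t(x)^* ξ'` continuous at `0`, the
quotient `t⁻¹⟨θ_t, w_t⟩` has the same limit as `t⁻¹⟨θ_0, w_t⟩`, which is `0` because `k_0` is known
explicitly and the same cancellation occurs. By adaptedness `t⁻¹⟨θ_t, w_t⟩` also tends to `∑ aᵢ ⟨v',
G c' cᵢ (x) v⟩`, so `∑ aᵢ G c' cᵢ = 0`. Exchanging the roles of `k_t(x)` and its adjoint treats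
`c'`.

For the equation, step functions are constant just to the right of each `r`, so the cocycle law
gives `k^{g',g}_s = k^{g',g}_r P^{c',c}_{s-r}` there. Hence matrix elements are continuous and have
the required right derivative at every point; this derivative is bounded on compact intervals, and
the fundamental theorem of calculus for right derivatives concludes. -/

theorem inner_ket {E F : Type*} [NormedAddCommGroup E] [InnerProductSpace ℂ E]
    [NormedAddCommGroup F] [InnerProductSpace ℂ F] (e e' : F) (u u' : E) :
    inner ℂ (ket e u) (ket e' u') = inner ℂ u u' * inner ℂ e e' := by
  change inner ℂ ((u ⊗ₜ[ℂ] e : E ⊗[ℂ] F) : UniformSpace.Completion (E ⊗[ℂ] F))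
    ((u' ⊗ₜ[ℂ] e' : E ⊗[ℂ] F) : UniformSpace.Completion (E ⊗[ℂ] F)) = _
  rw [UniformSpace.Completion.inner_coe, TensorProduct.inner_tmul]

theorem ket_add {E F : Type*} [NormedAddCommGroup E] [InnerProductSpace ℂ E]
    [NormedAddCommGroup F] [InnerProductSpace ℂ F] (e f : F) (u : E) :
    ket (e + f) u = ket e u + ket f u :=
  ((UniformSpace.Completion.toComplL (𝕜 := ℂ)).comp (TensorProduct.mkL ℂ E F u)).map_add e f

theorem ket_smul {E F : Type*} [NormedAddCommGroup E] [InnerProductSpace ℂ E]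
    [NormedAddCommGroup F] [InnerProductSpace ℂ F] (a : ℂ) (e : F) (u : E) :
    ket (a • e) u = a • ket e u :=
  ((UniformSpace.Completion.toComplL (𝕜 := ℂ)).comp (TensorProduct.mkL ℂ E F u)).map_smul a e

variable {H : Type*} [NormedAddCommGroup H] [InnerProductSpace ℂ H]

theorem inner_powVec (f g : H) (n : ℕ) :
    inner ℂ (powVec f n) (powVec g n) = inner ℂ f g ^ n := by
  induction n with
  | zero =>
    change inner ℂ (EuclideanSpace.single PUnit.unit (1 : ℂ))
      (EuclideanSpace.single PUnit.unit (1 : ℂ)) = _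
    simp
  | succ n ih =>
    change inner ℂ (ket (powVec f n) f) (ket (powVec g n) g) = _
    rw [inner_ket, ih, pow_succ']

theorem inner_expVec (f g : H) :
    inner ℂ (expVec f) (expVec g) = Complex.exp (inner ℂ f g) := by
  have h1 : inner ℂ (expVec f) (expVec g) =
      ∑' n, inner ℂ ((expVec f).1 n) ((expVec g).1 n) :=
    lp.inner_eq_tsum (𝕜 := ℂ) (G := fun n : ℕ => symPow H n) (expVec f) (expVec g)
  rw [h1, Complex.exp_eq_exp_ℂ, NormedSpace.exp_eq_tsum_div]
  refine tsum_congr fun n => ?_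
  change inner ℂ (((Real.sqrt (n.factorial : ℝ))⁻¹ : ℂ) • powVec f n)
    (((Real.sqrt (n.factorial : ℝ))⁻¹ : ℂ) • powVec g n) = _
  have h2 : (Real.sqrt (n.factorial : ℝ) : ℂ) * Real.sqrt (n.factorial : ℝ) = n.factorial := by
    rw [← Complex.ofReal_mul, Real.mul_self_sqrt (by positivity), Complex.ofReal_natCast]
  rw [inner_smul_left, inner_smul_right, inner_powVec, map_inv₀, Complex.conj_ofReal,
    ← mul_assoc, ← mul_inv, h2, div_eq_inv_mul]

end InnerProducts

/-! ### Step functions: inner products, one-sided limits, finite range. -/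

section StepFunctions

variable {K : Type*} [NormedAddCommGroup K] [InnerProductSpace ℂ K] {D D' : Submodule ℂ K}

theorem Step.inner_toL2 (g' : Step D') (g : Step D) :
    inner ℂ (Step.toL2 g') (Step.toL2 g) =
      ∫ s, inner ℂ ((g' : ℝ≥0 → K) s) ((g : ℝ≥0 → K) s) ∂leb := by
  rw [L2.inner_def]
  refine integral_congr_ae ?_
  filter_upwards [(Step.memLp g').coeFn_toLp, (Step.memLp g).coeFn_toLp] with s h1 h2
  rw [Step.toL2, Step.toL2, h1, h2]

theorem Step.integrable_inner (g' : Step D') (g : Step D) :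
    Integrable (fun s => inner ℂ ((g' : ℝ≥0 → K) s) ((g : ℝ≥0 → K) s)) leb := by
  refine (L2.integrable_inner (𝕜 := ℂ) (Step.toL2 g') (Step.toL2 g)).congr ?_
  filter_upwards [(Step.memLp g').coeFn_toLp, (Step.memLp g).coeFn_toLp] with s h1 h2
  rw [Step.toL2, Step.toL2, h1, h2]

theorem Step.trunc_apply (t : ℝ≥0) (g : Step D) (s : ℝ≥0) :
    (Step.trunc t g : ℝ≥0 → K) s = if s < t then (g : ℝ≥0 → K) s else 0 := by
  simp [Step.trunc, Set.indicator]

theorem Step.const_apply (t : ℝ≥0) (d : D) (s : ℝ≥0) :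
    (Step.const t d : ℝ≥0 → K) s = if s < t then (d : K) else 0 := by
  simp [Step.const, Set.indicator]

theorem Step.tail_apply (t : ℝ≥0) (g : Step D) (s : ℝ≥0) :
    (Step.tail t g : ℝ≥0 → K) s = if s < t then 0 else (g : ℝ≥0 → K) s := by
  change (g : ℝ≥0 → K) s - (Step.trunc t g : ℝ≥0 → K) s = _
  rw [Step.trunc_apply]
  split_ifs <;> simp

theorem Step.inner_trunc_add_tail (t : ℝ≥0) (g' : Step D') (g : Step D) :
    inner ℂ (Step.toL2 (Step.trunc t g')) (Step.toL2 (Step.trunc t g)) +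
      inner ℂ (Step.toL2 (Step.tail t g')) (Step.toL2 (Step.tail t g)) =
    inner ℂ (Step.toL2 g') (Step.toL2 g) := by
  rw [Step.inner_toL2, Step.inner_toL2, Step.inner_toL2,
    ← integral_add (Step.integrable_inner _ _) (Step.integrable_inner _ _)]
  refine integral_congr_ae (Eventually.of_forall fun s => ?_)
  simp only [Step.trunc_apply, Step.tail_apply]
  split_ifs <;> simp

/-- The horizons `r` and `t` differ so that one vector can be held fixed while `t → 0`; only the
shorter horizon counts. -/
theorem Step.inner_const {r t : ℝ≥0} (hrt : t ≤ r) (c' : D') (c : D) :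
    inner ℂ (Step.toL2 (Step.const r c')) (Step.toL2 (Step.const t c)) =
      (t : ℝ) * inner ℂ (c' : K) (c : K) := by
  rw [Step.inner_toL2]
  have h : (fun s => inner ℂ ((Step.const r c' : ℝ≥0 → K) s) ((Step.const t c : ℝ≥0 → K) s)) =
      (Set.Iio t).indicator fun _ => inner ℂ (c' : K) (c : K) := by
    funext s
    simp only [Step.const_apply, Set.indicator, Set.mem_Iio]
    by_cases hs : s < t
    · simp [hs, hs.trans_le hrt]
    · simp [hs]
  rw [h, integral_indicator_const _ measurableSet_Iio, measureReal_def, leb_Iio]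
  simp

theorem Step.inner_const' {r t : ℝ≥0} (hrt : t ≤ r) (c' : D') (c : D) :
    inner ℂ (Step.toL2 (Step.const t c')) (Step.toL2 (Step.const r c)) =
      (t : ℝ) * inner ℂ (c' : K) (c : K) := by
  rw [← inner_conj_symm, Step.inner_const hrt, map_mul, inner_conj_symm, Complex.conj_ofReal]

theorem Step.inner_exp (g' : Step D') (g : Step D) :
    inner ℂ (Step.exp g') (Step.exp g) =
      Complex.exp (inner ℂ (Step.toL2 g') (Step.toL2 g)) :=
  inner_expVec _ _

/-- Adaptedness is tested against all `K`-valued step functions, so a `D'`-valued one has to be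
viewed as such. -/
theorem Step.mem_top (g : Step D) : (g : ℝ≥0 → K) ∈ Step (⊤ : Submodule ℂ K) := by
  refine Submodule.span_mono ?_ g.2
  rintro f ⟨d, -, t, rfl⟩
  exact ⟨d, trivial, t, rfl⟩

theorem Step.eventually_eq_right (g : Step D) (r : ℝ≥0) :
    ∀ᶠ s in 𝓝[≥] r, (g : ℝ≥0 → K) s = (g : ℝ≥0 → K) r := by
  obtain ⟨g, hg⟩ := g
  change ∀ᶠ s in 𝓝[≥] r, g s = g r
  induction hg using Submodule.span_induction with
  | mem f hf =>
    obtain ⟨d, hd, t, rfl⟩ := hf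
    by_cases h : r < t
    · filter_upwards [mem_nhdsWithin_of_mem_nhds (Iio_mem_nhds h)] with s hs
      simp only [Set.mem_Iio] at hs
      simp [Set.indicator, h, hs]
    · filter_upwards [self_mem_nhdsWithin] with s hs
      have : ¬ s < t := fun h' => h (lt_of_le_of_lt hs h')
      simp [Set.indicator, h, this]
  | zero => exact Eventually.of_forall fun _ => rfl
  | add f g _ _ hf hg =>
    filter_upwards [hf, hg] with s h1 h2
    simp [h1, h2]
  | smul a f _ hf =>
    filter_upwards [hf] with s h1
    simp [h1]

/-- The left limit at `r` may differ from the value at `r`, so it appears as a separate vector. -/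
theorem Step.exists_eventually_eq_left (g : Step D) (r : ℝ≥0) :
    ∃ d : K, ∀ᶠ s in 𝓝[<] r, (g : ℝ≥0 → K) s = d := by
  obtain ⟨g, hg⟩ := g
  change ∃ d : K, ∀ᶠ s in 𝓝[<] r, g s = d
  induction hg using Submodule.span_induction with
  | mem f hf =>
    obtain ⟨d, hd, t, rfl⟩ := hf
    by_cases h : r ≤ t
    · refine ⟨d, ?_⟩
      filter_upwards [self_mem_nhdsWithin] with s hs
      simp [Set.indicator, lt_of_lt_of_le hs h]
    · refine ⟨0, ?_⟩
      filter_upwards [mem_nhdsWithin_of_mem_nhds (Ioi_mem_nhds (not_le.1 h))] with s hs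
      simp [Set.indicator, le_of_lt (Set.mem_Ioi.1 hs)]
  | zero => exact ⟨0, Eventually.of_forall fun _ => rfl⟩
  | add f g _ _ hf hg =>
    obtain ⟨a, ha⟩ := hf
    obtain ⟨b, hb⟩ := hg
    refine ⟨a + b, ?_⟩
    filter_upwards [ha, hb] with s h1 h2
    simp [h1, h2]
  | smul a f _ hf =>
    obtain ⟨b, hb⟩ := hf
    refine ⟨a • b, ?_⟩
    filter_upwards [hb] with s h1
    simp [h1]

/-- Serves to bound the integrand: only finitely many coefficients of the equation occur for given
`g'` and `g`. -/
theorem Step.finite_range (g : Step D) : (Set.range (g : ℝ≥0 → K)).Finite := by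
  obtain ⟨g, hg⟩ := g
  change (Set.range g).Finite
  induction hg using Submodule.span_induction with
  | mem f hf =>
    obtain ⟨d, hd, t, rfl⟩ := hf
    refine (Set.toFinite {d, 0}).subset ?_
    rintro _ ⟨s, rfl⟩
    by_cases h : s < t <;> simp [Set.indicator, h]
  | zero => exact (Set.finite_singleton 0).subset (by rintro _ ⟨s, rfl⟩; rfl)
  | add f g _ _ hf hg =>
    refine (Set.Finite.image2 (· + ·) hf hg).subset ?_
    rintro _ ⟨s, rfl⟩
    exact ⟨f s, ⟨s, rfl⟩, g s, ⟨s, rfl⟩, rfl⟩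
  | smul a f _ hf =>
    refine (hf.image (a • ·)).subset ?_
    rintro _ ⟨s, rfl⟩
    exact ⟨f s, ⟨s, rfl⟩, rfl⟩

end StepFunctions

/-! ### Matrix elements of a process and the cocycle law. -/

section Processes

variable {K : Type*} [NormedAddCommGroup K] [InnerProductSpace ℂ K] {D D' : Submodule ℂ K}
variable {h : Type*} [NormedAddCommGroup h] [InnerProductSpace ℂ h]
variable {h' : Type*} [NormedAddCommGroup h'] [InnerProductSpace ℂ h'] [CompleteSpace h']
variable {V : Submodule ℂ (h →L[ℂ] h')}

theorem coe_uExp (u : h) (g : Step D) :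
    (uExp u g : HTensor h (NoiseFock K)) = ket (Step.exp g) u := rfl

theorem inner_uExp (u u' : h) (g' : Step D') (g : Step D) :
    inner ℂ (uExp u' g' : HTensor h (NoiseFock K)) (uExp u g : HTensor h (NoiseFock K)) =
      inner ℂ u' u * Complex.exp (inner ℂ (Step.toL2 g') (Step.toL2 g)) := by
  rw [coe_uExp, coe_uExp, inner_ket, Step.inner_exp]

namespace Proc

theorem inner_sliceMap (k : Proc V D D') (t : ℝ≥0) (e' : Exps D') (e : Exps D) (x : V)
    (v' : h') (v : h) :
    inner ℂ v' ((k.sliceMap t e' e x : h →L[ℂ] h') v) =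
      inner ℂ (ket (e' : NoiseFock K) v') (k.toFun t x (ketD e v)) := by
  have h1 : (k.sliceMap t e' e x : h →L[ℂ] h') v =
      bra (e' : NoiseFock K) (k.toFun t x (ketD e v)) :=
    (Classical.choose_spec (k.slice_mem t x e' e) v).symm
  rw [h1, bra, ContinuousLinearMap.adjoint_inner_right]

/-- The matrix elements of a process between exponential vectors, in terms of its maps
`k^{g',g}_t`. -/
theorem inner_uExp_toFun (k : Proc V D D') (t : ℝ≥0) (x : V) (v' : h') (g' : Step D') (v : h)
    (g : Step D) :
    inner ℂ (uExp v' g' : HTensor h' (NoiseFock K)) (k.toFun t x (uExp v g)) =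
      Complex.exp (inner ℂ (Step.toL2 g') (Step.toL2 g)) *
        inner ℂ v' ((k.form g' g t x : h →L[ℂ] h') v) := by
  have h1 : inner ℂ (uExp v' g' : HTensor h' (NoiseFock K)) (k.toFun t x (uExp v g)) =
      inner ℂ (uExp v' (Step.trunc t g') : HTensor h' (NoiseFock K))
        (k.toFun t x (uExp v (Step.trunc t g))) *
        inner ℂ (Step.exp (Step.tail t g')) (Step.exp (Step.tail t g)) :=
    k.adapted x t v g v' ⟨g', Step.mem_top g'⟩
  have h2 : inner ℂ v' ((k.form g' g t x : h →L[ℂ] h') v) =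
      Complex.exp (-inner ℂ (Step.toL2 (Step.trunc t g')) (Step.toL2 (Step.trunc t g))) *
      inner ℂ (uExp v' (Step.trunc t g') : HTensor h' (NoiseFock K))
        (k.toFun t x (uExp v (Step.trunc t g))) := by
    rw [form, LinearMap.smul_apply, Submodule.coe_smul, _root_.smul_apply, inner_smul_right,
      inner_sliceMap]
    rfl
  -- The normalising factor of `form` cancels the part of the exponent before `t`; adaptedness
  -- supplies the part after `t`.
  rw [h1, h2, Step.inner_exp, ← Step.inner_trunc_add_tail t g' g, ← mul_assoc, ← Complex.exp_add,
    mul_comm]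
  congr 2
  ring

theorem form_congr (k : Proc V D D') {t : ℝ≥0} {g₁' g₂' : Step D'} {g₁ g₂ : Step D}
    (h1 : ∀ s < t, (g₁' : ℝ≥0 → K) s = (g₂' : ℝ≥0 → K) s)
    (h2 : ∀ s < t, (g₁ : ℝ≥0 → K) s = (g₂ : ℝ≥0 → K) s) :
    k.form g₁' g₁ t = k.form g₂' g₂ t := by
  have h3 : Step.trunc t g₁' = Step.trunc t g₂' := by
    ext s
    rw [Step.trunc_apply, Step.trunc_apply]
    split_ifs with hs
    · exact h1 s hs
    · rfl
  have h4 : Step.trunc t g₁ = Step.trunc t g₂ := by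
    ext s
    rw [Step.trunc_apply, Step.trunc_apply]
    split_ifs with hs
    · exact h2 s hs
    · rfl
  simp only [form, h3, h4]

/-- The maps `k^{g',g}_t` of an initial space bounded process, as bounded operators. -/
noncomputable def formL (k : Proc V D D') (hb : k.InitialSpaceBounded) (g' : Step D')
    (g : Step D) (t : ℝ≥0) : V →L[ℂ] V :=
  ⟨k.form g' g t, hb g' g t⟩

theorem formL_eq_assocSemigroup (k : Proc V D D') (hb : k.InitialSpaceBounded) {t : ℝ≥0}
    {g' : Step D'} {g : Step D} {c' : D'} {c : D}
    (h1 : ∀ s < t, (g' : ℝ≥0 → K) s = c') (h2 : ∀ s < t, (g : ℝ≥0 → K) s = c) :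
    k.formL hb g' g t = k.assocSemigroup hb c' c t := by
  ext1 x
  change k.form g' g t x = k.form _ _ t x
  rw [k.form_congr]
  · intro s hs
    rw [h1 s hs, Step.const_apply, if_pos hs]
  · intro s hs
    rw [h2 s hs, Step.const_apply, if_pos hs]

namespace IsCocycle

theorem formL_zero {k : Proc V D D'} (hk : k.IsCocycle) (hb : k.InitialSpaceBounded)
    (g' : Step D') (g : Step D) : k.formL hb g' g 0 = 1 := by
  ext1 x
  change k.form g' g 0 x = x
  rw [hk.zero]
  rfl

/-- Where both step functions are constant on `[r, r+t[`, their shifts agree with constants on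
`[0,t[`, so the second factor of the cocycle law is a semigroup element. -/
theorem formL_add {k : Proc V D D'} (hk : k.IsCocycle) (hb : k.InitialSpaceBounded)
    {g' : Step D'} {g : Step D} {c' : D'} {c : D} {r t : ℝ≥0}
    (h1 : ∀ s, r ≤ s → s < r + t → (g' : ℝ≥0 → K) s = c')
    (h2 : ∀ s, r ≤ s → s < r + t → (g : ℝ≥0 → K) s = c) :
    k.formL hb g' g (r + t) = k.formL hb g' g r * k.assocSemigroup hb c' c t := by
  have h3 : k.formL hb (Step.shift r g') (Step.shift r g) t = k.assocSemigroup hb c' c t := by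
    refine k.formL_eq_assocSemigroup hb (fun s hs => ?_) fun s hs => ?_
    · exact h1 (s + r) le_add_self (by rw [add_comm r]; gcongr)
    · exact h2 (s + r) le_add_self (by rw [add_comm r]; gcongr)
  rw [← h3]
  ext1 x
  change k.form g' g (r + t) x = _
  rw [hk.add]
  rfl

theorem assocSemigroup_zero {k : Proc V D D'} (hk : k.IsCocycle) (hb : k.InitialSpaceBounded)
    (c' : D') (c : D) : k.assocSemigroup hb c' c 0 = 1 :=
  hk.formL_zero hb _ _

theorem assocSemigroup_add {k : Proc V D D'} (hk : k.IsCocycle) (hb : k.InitialSpaceBounded)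
    (c' : D') (c : D) (r t : ℝ≥0) :
    k.assocSemigroup hb c' c (r + t) =
      k.assocSemigroup hb c' c r * k.assocSemigroup hb c' c t := by
  -- Cutting the constants off at `r + t` instead of `r` does not affect the map at time `r`.
  have h1 : k.formL hb (Step.const (r + t) c') (Step.const (r + t) c) r =
      k.assocSemigroup hb c' c r := by
    refine k.formL_eq_assocSemigroup hb (fun s hs => ?_) fun s hs => ?_ <;>
    rw [Step.const_apply, if_pos (hs.trans_le le_self_add)]
  rw [← h1]
  refine hk.formL_add hb (fun s _ hs => ?_) fun s _ hs => ?_ <;>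
  rw [Step.const_apply, if_pos hs]

end IsCocycle

end Proc

end Processes

/-! ### Generators of norm-continuous semigroups. -/

section Semigroups

theorem tendsto_coe_nhdsGT_zero : Tendsto ((↑) : ℝ≥0 → ℝ) (𝓝[>] 0) (𝓝[>] 0) :=
  tendsto_nhdsWithin_iff.2 ⟨(NNReal.continuous_coe.tendsto 0).mono_left nhdsWithin_le_nhds,
    by filter_upwards [self_mem_nhdsWithin] with t ht using NNReal.coe_pos.2 ht⟩

theorem tendsto_toNNReal_nhdsGT_zero : Tendsto Real.toNNReal (𝓝[>] 0) (𝓝[>] 0) := by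
  refine tendsto_nhdsWithin_iff.2 ⟨?_, ?_⟩
  · have := (continuous_real_toNNReal.tendsto 0).mono_left
      (nhdsWithin_le_nhds (s := Set.Ioi (0 : ℝ)))
    rwa [Real.toNNReal_zero] at this
  · filter_upwards [self_mem_nhdsWithin] with t ht using Real.toNNReal_pos.2 ht

theorem isGenerator_of_hasDerivWithinAt {X : Type*} [NormedAddCommGroup X] [NormedSpace ℂ X]
    {P : ℝ≥0 → X →L[ℂ] X} (h0 : P 0 = 1) {ψ : X →L[ℂ] X}
    (hψ : HasDerivWithinAt (fun s : ℝ => P s.toNNReal) ψ (Set.Ioi 0) 0) : IsGenerator P ψ := by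
  rw [hasDerivWithinAt_iff_tendsto_slope' (by simp)] at hψ
  refine (hψ.comp tendsto_coe_nhdsGT_zero).congr' ?_
  filter_upwards [self_mem_nhdsWithin] with t ht
  rw [Function.comp_apply, slope_def_module, Real.toNNReal_zero, h0, sub_zero,
    Real.toNNReal_coe, ← Complex.ofReal_inv, Complex.coe_smul]
  rfl

/-- A norm-continuous one-parameter semigroup in a Banach algebra is differentiable at `0`. -/
theorem exists_hasDerivWithinAt_of_semigroup {A : Type*} [NormedRing A] [NormedAlgebra ℝ A]
    [CompleteSpace A] {P : ℝ≥0 → A} (hP : Continuous P) (h0 : P 0 = 1)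
    (hadd : ∀ s t, P (s + t) = P s * P t) :
    ∃ ψ : A, HasDerivWithinAt (fun s : ℝ => P s.toNNReal) ψ (Set.Ioi 0) 0 := by
  have hQ : Continuous fun s : ℝ => P s.toNNReal := hP.comp continuous_real_toNNReal
  set Q : ℝ → A := fun s => P s.toNNReal with hQdef
  have hQ0 : Q 0 = 1 := by simp [hQdef, h0]
  set J : ℝ → A := fun t => ∫ s in (0 : ℝ)..t, Q s with hJ
  have hJd : ∀ t, HasDerivAt J (Q t) t := fun t => hQ.integral_hasStrictDerivAt 0 t |>.hasDerivAt
  have hJ0 : J 0 = 0 := by simp [hJ]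
  -- `τ⁻¹ J(τ) → Q 0 = 1` and the units are open, so `J(τ)` is invertible for some small `τ > 0`.
  obtain ⟨τ, hτ, hu⟩ : ∃ τ : ℝ, 0 < τ ∧ IsUnit (J τ) := by
    have h1 := (hasDerivWithinAt_iff_tendsto_slope' (s := Set.Ioi (0 : ℝ)) (by simp)).1
      (hJd 0).hasDerivWithinAt
    rw [hQ0] at h1
    have h2 := h1.eventually (Units.isOpen.mem_nhds (show (1 : A) ∈ {x | IsUnit x} from isUnit_one))
    obtain ⟨τ, h3, h4⟩ := (h2.and self_mem_nhdsWithin).exists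
    refine ⟨τ, h4, ?_⟩
    rw [slope_def_module, hJ0, sub_zero, sub_zero] at h3
    have hτ : τ ≠ 0 := ne_of_gt h4
    have h5 := h3.smul (Units.mk0 τ hτ)
    rwa [Units.smul_def, Units.val_mk0, smul_smul, mul_inv_cancel₀ hτ, one_smul] at h5
  obtain ⟨U, hU⟩ := hu
  -- The semigroup law turns `Q t * J τ` into the integral of `Q` over `[t, τ + t]`. Dividing by `J
  -- τ` writes `Q` through the differentiable function `J`.
  have key : ∀ t : ℝ, 0 ≤ t → Q t = (J (τ + t) - J t) * (↑U⁻¹ : A) := by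
    intro t ht
    rw [Units.eq_mul_inv_iff_mul_eq, hU]
    have h1 : J (τ + t) - J t = ∫ s in t..(τ + t), Q s := by
      rw [hJ, intervalIntegral.integral_interval_sub_left] <;>
      exact hQ.intervalIntegrable _ _
    have h2 : ∫ s in t..(τ + t), Q s = ∫ s in (0 : ℝ)..τ, Q (s + t) := by
      rw [intervalIntegral.integral_comp_add_right, zero_add]
    have h3 : ∫ s in (0 : ℝ)..τ, Q (s + t) = ∫ s in (0 : ℝ)..τ, Q t * Q s := by
      refine intervalIntegral.integral_congr fun s hs => ?_
      rw [Set.uIcc_of_le hτ.le] at hs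
      simp only [hQdef]
      rw [Real.toNNReal_add hs.1 ht, add_comm, hadd]
    rw [h1, h2, h3]
    exact (ContinuousLinearMap.intervalIntegral_comp_comm (ContinuousLinearMap.mul ℝ A (Q t))
      (hQ.intervalIntegrable 0 τ)).symm
  refine ⟨(Q τ - 1) * (↑U⁻¹ : A), ?_⟩
  have h1 : HasDerivAt (fun t => (J (τ + t) - J t) * (↑U⁻¹ : A)) ((Q τ - 1) * (↑U⁻¹ : A)) 0 := by
    refine HasDerivAt.mul_const ?_ _
    refine HasDerivAt.sub ?_ (hQ0 ▸ hJd 0)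
    exact HasDerivAt.comp_const_add τ 0 (by simpa using hJd τ)
  exact h1.hasDerivWithinAt.congr (fun t ht => key t (le_of_lt ht)) (key 0 le_rfl)

theorem exists_isGenerator {X : Type*} [NormedAddCommGroup X] [NormedSpace ℂ X] [CompleteSpace X]
    {P : ℝ≥0 → X →L[ℂ] X} (hP : Continuous P) (h0 : P 0 = 1)
    (hadd : ∀ s t, P (s + t) = P s * P t) : ∃ ψ, IsGenerator P ψ := by
  obtain ⟨ψ, hψ⟩ := exists_hasDerivWithinAt_of_semigroup hP h0 hadd
  exact ⟨ψ, isGenerator_of_hasDerivWithinAt h0 hψ⟩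

theorem continuous_mul_comp_tsub {X : Type*} [NormedAddCommGroup X] [NormedSpace ℂ X]
    {P : ℝ≥0 → X →L[ℂ] X} (hP : Continuous P) (T : X →L[ℂ] X) (r : ℝ≥0) :
    Continuous fun s => T * P (s - r) :=
  continuous_const.mul (hP.comp (by fun_prop))

theorem exists_norm_apply_le_of_continuous {X : Type*} [NormedAddCommGroup X] [NormedSpace ℂ X]
    {P : ℝ≥0 → X →L[ℂ] X} (hP : Continuous P) (t : ℝ≥0) :
    ∃ B, 0 ≤ B ∧ ∀ s ∈ Set.Icc 0 t, ∀ x, ‖P s x‖ ≤ B * ‖x‖ := by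
  obtain ⟨B, hB⟩ := (isCompact_Icc (a := (0 : ℝ≥0)) (b := t)).exists_bound_of_continuousOn
    hP.continuousOn
  exact ⟨B, (norm_nonneg _).trans (hB 0 ⟨le_rfl, zero_le⟩),
    fun s hs x => (P s).le_of_opNorm_le (hB s hs) x⟩

end Semigroups

/-! ### From affine maps on `D` to linear maps on `Hat D`. -/

section HatExtension

variable {K : Type*} [NormedAddCommGroup K] [InnerProductSpace ℂ K] {D : Submodule ℂ K}

theorem Hat.snd_mem (z : Hat D) : (z : WithLp 2 (ℂ × K)).snd ∈ D := by
  obtain ⟨z, hz⟩ := z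
  change z.snd ∈ D
  induction hz using Submodule.span_induction with
  | mem f hf =>
    obtain ⟨d, hd, rfl⟩ := hf
    exact hd
  | zero => exact D.zero_mem
  | add f g _ _ hf hg => exact D.add_mem hf hg
  | smul a f _ hf => exact D.smul_mem a hf

/-- A map on `D` which is affine relative to `σ` extends along `c ↦ (1, c)` to a `σ`-semilinear
map. -/
theorem Hat.exists_semilinear_extension {σ : ℂ →+* ℂ} {X : Type*} [AddCommGroup X] [Module ℂ X]
    (f : D → X)
    (hf : ∀ (a : Fin 4 → ℂ) (c : Fin 4 → D), ∑ i, a i = 0 → ∑ i, a i • c i = 0 →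
      ∑ i, σ (a i) • f (c i) = 0) :
    ∃ F : Hat D →ₛₗ[σ] X, ∀ c : D, F (Hat.mk c) = f c := by
  have haff : ∀ (a b : ℂ) (c d : D),
      f (a • c + b • d) = σ a • f c + σ b • f d + (1 - σ a - σ b) • f 0 := by
    intro a b c d
    -- Four points suffice: the combination, its two constituents, and `0`, whose weight makes the
    -- total vanish.
    have h1 := hf ![1, -a, -b, a + b - 1] ![a • c + b • d, c, d, 0]
      (by simp only [Fin.sum_univ_four, Matrix.cons_val]; ring)
      (by simp only [Fin.sum_univ_four, Matrix.cons_val]; module)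
    simp only [Fin.sum_univ_four, Matrix.cons_val, map_neg, map_sub, map_add, map_one] at h1
    rw [← sub_eq_zero, ← h1]
    module
  let p : Hat D → D := fun z => ⟨(z : WithLp 2 (ℂ × K)).snd, Hat.snd_mem z⟩
  -- By `haff`, `f - f 0` is `σ`-semilinear on `D`; the scalar component of `z` carries the constant
  -- `f 0`.
  refine ⟨
    { toFun := fun z => σ (z : WithLp 2 (ℂ × K)).fst • f 0 + (f (p z) - f 0)
      map_add' := ?_
      map_smul' := ?_ }, ?_⟩
  · intro y z
    have h1 : p (y + z) = (1 : ℂ) • p y + (1 : ℂ) • p z := by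
      rw [one_smul, one_smul]
      rfl
    have h2 : ((y + z : Hat D) : WithLp 2 (ℂ × K)).fst =
      (y : WithLp 2 (ℂ × K)).fst + (z : WithLp 2 (ℂ × K)).fst := rfl
    rw [h1, h2, haff, map_add, map_one]
    module
  · intro a z
    have h1 : p (a • z) = a • p z + (0 : ℂ) • 0 := by
      rw [zero_smul, add_zero]
      rfl
    have h2 : ((a • z : Hat D) : WithLp 2 (ℂ × K)).fst = a * (z : WithLp 2 (ℂ × K)).fst := rfl
    rw [h1, h2, haff, map_mul, map_zero]
    module
  · intro c
    change σ 1 • f 0 + (f c - f 0) = f c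
    rw [map_one]
    module

theorem Hat.linearMap_ext {X : Type*} [AddCommGroup X] [Module ℂ X] {F G : Hat D →ₗ[ℂ] X}
    (H : ∀ c : D, F (Hat.mk c) = G (Hat.mk c)) : F = G := by
  ext1 z
  obtain ⟨z, hz⟩ := z
  induction hz using Submodule.span_induction with
  | mem z hz =>
    obtain ⟨d, hd, rfl⟩ := hz
    exact H ⟨d, hd⟩
  | zero => exact (map_zero F).trans (map_zero G).symm
  | add y z hy hz h1 h2 =>
    exact ((map_add F ⟨y, hy⟩ ⟨z, hz⟩).trans (congrArg₂ (· + ·) h1 h2)).trans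
      (map_add G ⟨y, hy⟩ ⟨z, hz⟩).symm
  | smul a z hz h1 =>
    exact ((map_smul F a ⟨z, hz⟩).trans (congrArg (a • ·) h1)).trans
      (map_smul G a ⟨z, hz⟩).symm

/-- A map on `D' × D` which is affine on the right and conjugate-affine on the left extends along
`(c', c) ↦ ((1, c'), (1, c))` to a sesquilinear map. -/
theorem Hat.exists_sesquilinear_extension {D' : Submodule ℂ K} {X : Type*} [AddCommGroup X]
    [Module ℂ X] (G : D' → D → X)
    (hright : ∀ (c' : D') (a : Fin 4 → ℂ) (c : Fin 4 → D), ∑ i, a i = 0 → ∑ i, a i • c i = 0 →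
      ∑ i, a i • G c' (c i) = 0)
    (hleft : ∀ (c : D) (a : Fin 4 → ℂ) (c' : Fin 4 → D'), ∑ i, a i = 0 → ∑ i, a i • c' i = 0 →
      ∑ i, conj (a i) • G (c' i) c = 0) :
    ∃ φ : Hat D' →ₗ⋆[ℂ] Hat D →ₗ[ℂ] X, ∀ c' c, φ (Hat.mk c') (Hat.mk c) = G c' c := by
  choose F hF using fun c' =>
    Hat.exists_semilinear_extension (σ := RingHom.id ℂ) (G c') (hright c')
  obtain ⟨φ, hφ⟩ := Hat.exists_semilinear_extension (σ := starRingEnd ℂ) F fun a c' ha hc => by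
    refine Hat.linearMap_ext fun c => ?_
    simp only [LinearMap.sum_apply, LinearMap.smul_apply, hF]
    exact hleft c a c' ha hc
  exact ⟨φ, fun c' c => by rw [hφ, hF]⟩

theorem Hat.exists_sesquilinear_isGenerator {D' : Submodule ℂ K} {X : Type*}
    [NormedAddCommGroup X] [NormedSpace ℂ X] {P : D' → D → ℝ≥0 → X →L[ℂ] X}
    {G : D' → D → X →L[ℂ] X} (hG : ∀ c' c, IsGenerator (P c' c) (G c' c))
    (hright : ∀ (c' : D') (a : Fin 4 → ℂ) (c : Fin 4 → D), ∑ i, a i = 0 → ∑ i, a i • c i = 0 →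
      ∑ i, a i • G c' (c i) = 0)
    (hleft : ∀ (c : D) (a : Fin 4 → ℂ) (c' : Fin 4 → D'), ∑ i, a i = 0 → ∑ i, a i • c' i = 0 →
      ∑ i, conj (a i) • G (c' i) c = 0) :
    ∃ φ : Hat D' →ₗ⋆[ℂ] Hat D →ₗ[ℂ] (X →L[ℂ] X),
      ∀ c' c, IsGenerator (P c' c) (φ (Hat.mk c') (Hat.mk c)) := by
  obtain ⟨φ, hφ⟩ := Hat.exists_sesquilinear_extension G hright hleft
  exact ⟨φ, fun c' c => by rw [hφ]; exact hG c' c⟩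

end HatExtension

/-! ### Scalar limits at `0`. -/

section Limits

theorem tendsto_inv_mul_exp_sub_one (z : ℂ) :
    Tendsto (fun t : ℝ≥0 => ((t : ℝ) : ℂ)⁻¹ * (Complex.exp ((t : ℝ) * z) - 1)) (𝓝[>] 0) (𝓝 z) := by
  have h1 : HasDerivAt (fun s : ℝ => Complex.exp ((s : ℂ) * z)) z 0 := by
    have h2 : HasDerivAt (fun s : ℝ => (s : ℂ) * z) z 0 := by
      simpa using (Complex.ofRealCLM.hasDerivAt (x := (0 : ℝ))).mul_const z
    simpa using h2.cexp
  have h3 := (hasDerivWithinAt_iff_tendsto_slope' (s := Set.Ioi (0 : ℝ)) (by simp)).1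
    h1.hasDerivWithinAt
  refine (h3.comp tendsto_coe_nhdsGT_zero).congr fun t => ?_
  simp [slope_def_module]

/-- Replacing `θ t` by `θ 0` costs at most `‖θ t - θ 0‖ * C` after division by `t`, which is where
the `O(t)` bound on `w` is needed. -/
theorem tendsto_inv_mul_inner_of_continuousAt {H : Type*} [NormedAddCommGroup H]
    [InnerProductSpace ℂ H] {θ w : ℝ≥0 → H} (hθ : ContinuousAt θ 0) {C : ℝ}
    (hw : ∀ᶠ t : ℝ≥0 in 𝓝[>] 0, ‖w t‖ ≤ C * t)
    (h0 : Tendsto (fun t : ℝ≥0 => ((t : ℝ) : ℂ)⁻¹ * inner ℂ (θ 0) (w t)) (𝓝[>] 0) (𝓝 0)) :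
    Tendsto (fun t : ℝ≥0 => ((t : ℝ) : ℂ)⁻¹ * inner ℂ (θ t) (w t)) (𝓝[>] 0) (𝓝 0) := by
  have h1 : Tendsto (fun t : ℝ≥0 => ((t : ℝ) : ℂ)⁻¹ * inner ℂ (θ t - θ 0) (w t))
      (𝓝[>] 0) (𝓝 0) := by
    have h2 : Tendsto (fun t => ‖θ t - θ 0‖ * C) (𝓝[>] 0) (𝓝 0) := by
      have h3 : Tendsto θ (𝓝[>] 0) (𝓝 (θ 0)) := hθ.tendsto.mono_left nhdsWithin_le_nhds
      simpa using ((h3.sub_const (θ 0)).norm).mul_const C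
    refine squeeze_zero_norm' ?_ h2
    filter_upwards [hw, self_mem_nhdsWithin] with t ht ht0
    have ht0' : (0 : ℝ) < t := NNReal.coe_pos.2 ht0
    rw [norm_mul, norm_inv, Complex.norm_real, Real.norm_of_nonneg ht0'.le,
      inv_mul_le_iff₀ ht0']
    calc ‖inner ℂ (θ t - θ 0) (w t)‖ ≤ ‖θ t - θ 0‖ * ‖w t‖ := norm_inner_le_norm _ _
      _ ≤ ‖θ t - θ 0‖ * (C * t) := by gcongr
      _ = t * (‖θ t - θ 0‖ * C) := by ring
  have h4 := h1.add h0
  rw [add_zero] at h4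
  refine h4.congr fun t => ?_
  rw [inner_sub_left]
  ring

/-- The two relations kill the orders `0` and `1` in `t` of the sum. -/
theorem tendsto_inv_mul_sum_mul_exp {ι : Type*} [Fintype ι] {b z : ι → ℂ} (hb : ∑ i, b i = 0)
    (hz : ∑ i, b i * z i = 0) (y : ℂ) :
    Tendsto (fun t : ℝ≥0 => ((t : ℝ) : ℂ)⁻¹ * ∑ i, b i * (Complex.exp ((t : ℝ) * z i) * y))
      (𝓝[>] 0) (𝓝 0) := by
  have h1 : Tendsto (fun t : ℝ≥0 => ∑ i, b i * (((t : ℝ) : ℂ)⁻¹ *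
      (Complex.exp ((t : ℝ) * z i) - 1)) * y) (𝓝[>] 0) (𝓝 (∑ i, b i * z i * y)) :=
    tendsto_finsetSum _ fun i _ => ((tendsto_inv_mul_exp_sub_one _).const_mul (b i)).mul_const _
  rw [← Finset.sum_mul, hz, zero_mul] at h1
  refine h1.congr fun t => ?_
  have h2 : ∑ i, b i * (((t : ℝ) : ℂ)⁻¹ * y) = 0 := by
    rw [← Finset.sum_mul, hb, zero_mul]
  rw [← add_zero (∑ i, _), ← h2, ← Finset.sum_add_distrib, Finset.mul_sum]
  refine Finset.sum_congr rfl fun i _ => ?_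
  ring

end Limits

/-! ### Second-order smallness of balanced sums of exponential vectors. -/

section ExponentialVectors

variable {K : Type*} [NormedAddCommGroup K] [InnerProductSpace ℂ K] {D D' : Submodule ℂ K}
variable {h : Type*} [NormedAddCommGroup h] [InnerProductSpace ℂ h]
variable {ι : Type*} [Fintype ι]

/-- If `∑ aᵢ = 0` and `∑ aᵢ cᵢ = 0` then the norm of `∑ aᵢ v ε((cᵢ)_{[0,t[})` is `O(t)`. -/
theorem exists_norm_sum_uExp_const_le (v : h) (a : ι → ℂ) (c : ι → D) (ha : ∑ i, a i = 0)
    (hc : ∑ i, a i • c i = 0) :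
    ∃ C : ℝ, ∀ᶠ t : ℝ≥0 in 𝓝[>] 0,
      ‖((∑ i, a i • uExp v (Step.const t (c i)) : expDomain h D) :
        HTensor h (NoiseFock K))‖ ≤ C * t := by
  -- `M` comes from `‖exp u - 1 - u‖ ≤ ‖u‖ ^ 2`, valid for `‖u‖ ≤ 1`, applied to each entry `u = t *
  -- z i j` of the Gram matrix.
  set z : ι → ι → ℂ := fun i j => inner ℂ (c i : K) (c j : K) with hz
  set M : ℝ := ‖v‖ ^ 2 * ∑ i, ∑ j, ‖a i‖ * ‖a j‖ * ‖z i j‖ ^ 2 with hM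
  have hM0 : 0 ≤ M := by positivity
  have hsmall : ∀ᶠ t : ℝ≥0 in 𝓝[>] 0, ∀ i j, ‖((t : ℝ) : ℂ) * z i j‖ ≤ 1 := by
    refine nhdsWithin_le_nhds ?_
    refine eventually_all.2 fun i => eventually_all.2 fun j => ?_
    have h1 : Continuous fun t : ℝ≥0 => ‖((t : ℝ) : ℂ) * z i j‖ := by fun_prop
    have h2 := h1.tendsto 0
    simp only [NNReal.coe_zero, Complex.ofReal_zero, zero_mul, norm_zero] at h2
    exact h2.eventually (eventually_le_nhds zero_lt_one)
  have hzz : ∑ i, ∑ j, conj (a i) * a j * z i j = 0 := by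
    have h1 : inner ℂ (∑ i, a i • (c i : K)) (∑ j, a j • (c j : K)) =
        ∑ i, ∑ j, conj (a i) * a j * z i j := by
      rw [sum_inner]
      refine Finset.sum_congr rfl fun i _ => ?_
      rw [inner_sum]
      refine Finset.sum_congr rfl fun j _ => ?_
      rw [inner_smul_left, inner_smul_right, mul_assoc]
    have h2 : ∑ i, a i • (c i : K) = 0 := by
      have := congrArg (Subtype.val) hc
      simpa using this
    rw [← h1, h2, inner_zero_left]
  have haa : ∑ i, ∑ j, conj (a i) * a j = 0 := by
    simp_rw [← Finset.mul_sum, ha, mul_zero, Finset.sum_const_zero]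
  refine ⟨Real.sqrt M, ?_⟩
  filter_upwards [hsmall] with t ht
  set w : HTensor h (NoiseFock K) :=
    ((∑ i, a i • uExp v (Step.const t (c i)) : expDomain h D) : HTensor h (NoiseFock K)) with hw
  -- By `haa` and `hzz` the subtracted orders `0` and `1` contribute nothing, leaving a sum of size
  -- `O(t ^ 2)`.
  have hww : inner ℂ w w = inner ℂ v v * ∑ i, ∑ j, conj (a i) * a j *
      (Complex.exp ((t : ℝ) * z i j) - 1 - (t : ℝ) * z i j) := by
    have h1 : inner ℂ w w = inner ℂ v v * ∑ i, ∑ j, conj (a i) * a j *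
        Complex.exp ((t : ℝ) * z i j) := by
      rw [hw, Submodule.coe_sum, sum_inner, Finset.mul_sum]
      refine Finset.sum_congr rfl fun i _ => ?_
      rw [inner_sum, Finset.mul_sum]
      refine Finset.sum_congr rfl fun j _ => ?_
      rw [Submodule.coe_smul, Submodule.coe_smul, inner_smul_left, inner_smul_right, inner_uExp,
        Step.inner_const le_rfl]
      ring
    have h2 : ∑ i, ∑ j, conj (a i) * a j *
        (Complex.exp ((t : ℝ) * z i j) - 1 - (t : ℝ) * z i j) =
        ∑ i, ∑ j, conj (a i) * a j * Complex.exp ((t : ℝ) * z i j) -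
          ∑ i, ∑ j, conj (a i) * a j - (t : ℝ) * ∑ i, ∑ j, conj (a i) * a j * z i j := by
      simp_rw [Finset.mul_sum, ← Finset.sum_sub_distrib]
      refine Finset.sum_congr rfl fun i _ => Finset.sum_congr rfl fun j _ => ?_
      ring
    rw [h1, h2, haa, hzz]
    simp
  have hbound : ‖w‖ ^ 2 ≤ M * (t : ℝ) ^ 2 := by
    have h1 : ‖w‖ ^ 2 = ‖inner ℂ w w‖ := by
      rw [inner_self_eq_norm_sq_to_K]
      simp
    have h2 : ‖inner ℂ v v‖ = ‖v‖ ^ 2 := by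
      rw [inner_self_eq_norm_sq_to_K]
      simp
    rw [h1, hww, norm_mul, h2, hM, mul_assoc, Finset.sum_mul]
    refine mul_le_mul_of_nonneg_left ?_ (by positivity)
    refine (norm_sum_le _ _).trans (Finset.sum_le_sum fun i _ => ?_)
    rw [Finset.sum_mul]
    refine (norm_sum_le _ _).trans (Finset.sum_le_sum fun j _ => ?_)
    rw [norm_mul, norm_mul, RCLike.norm_conj, mul_assoc (‖a i‖ * ‖a j‖)]
    refine mul_le_mul_of_nonneg_left ?_ (by positivity)
    refine (Complex.norm_exp_sub_one_sub_id_le (ht i j)).trans (le_of_eq ?_)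
    rw [norm_mul, Complex.norm_real, mul_pow, mul_comm, Real.norm_eq_abs, sq_abs]
  refine le_of_sq_le_sq ?_ (by positivity)
  rwa [mul_pow, Real.sq_sqrt hM0]

end ExponentialVectors

/-! ### Affine dependence of the generators on their indices. -/

section Generators

variable {K : Type*} [NormedAddCommGroup K] [InnerProductSpace ℂ K] {D D' : Submodule ℂ K}
variable {h : Type*} [NormedAddCommGroup h] [InnerProductSpace ℂ h]
variable {h' : Type*} [NormedAddCommGroup h'] [InnerProductSpace ℂ h']
variable {V : Submodule ℂ (h →L[ℂ] h')} {ι : Type*} [Fintype ι]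

theorem IsGenerator.tendsto_inner {P : ℝ≥0 → V →L[ℂ] V} {ψ : V →L[ℂ] V} (hψ : IsGenerator (X := V) P ψ)
    (z : ℂ) (x : V) (v' : h') (v : h) :
    Tendsto (fun t : ℝ≥0 => ((t : ℝ) : ℂ)⁻¹ * (Complex.exp ((t : ℝ) * z) *
        inner ℂ v' ((P t x : h →L[ℂ] h') v) - inner ℂ v' ((x : h →L[ℂ] h') v))) (𝓝[>] 0)
      (𝓝 (inner ℂ v' ((ψ x : h →L[ℂ] h') v) + z * inner ℂ v' ((x : h →L[ℂ] h') v))) := by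
  have hc : Continuous fun T : V →L[ℂ] V => inner ℂ v' ((T x : h →L[ℂ] h') v) := by fun_prop
  have h1 := (hc.tendsto ψ).comp hψ
  have h2 : Tendsto (fun t : ℝ≥0 => Complex.exp ((t : ℝ) * z)) (𝓝[>] 0) (𝓝 1) := by
    have h3 : Continuous fun t : ℝ≥0 => Complex.exp ((t : ℝ) * z) := by fun_prop
    have h4 := (h3.tendsto 0).mono_left (nhdsWithin_le_nhds (s := Set.Ioi (0 : ℝ≥0)))
    simpa using h4
  -- With `p` and `q` the two matrix elements, `e^{tz} p - q = e^{tz} (p - q) + (e^{tz} - 1) q`.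
  have h5 := (h2.mul h1).add
    ((tendsto_inv_mul_exp_sub_one z).mul_const (inner ℂ v' ((x : h →L[ℂ] h') v)))
  rw [one_mul] at h5
  refine h5.congr fun t => ?_
  have h6 : inner ℂ v' (((((t : ℝ) : ℂ)⁻¹ • (P t - ContinuousLinearMap.id ℂ V)) x :
      h →L[ℂ] h') v) = ((t : ℝ) : ℂ)⁻¹ * (inner ℂ v' ((P t x : h →L[ℂ] h') v) -
        inner ℂ v' ((x : h →L[ℂ] h') v)) := by
    rw [_root_.smul_apply, Submodule.coe_smul, _root_.smul_apply, inner_smul_right, _root_.sub_apply,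
      Submodule.coe_sub, _root_.sub_apply, inner_sub_right]
    rfl
  rw [Function.comp_apply, h6]
  ring

/-- Common end of both affinity arguments. The weighted sum of exponentials times semigroup matrix
elements has two limits after division by `t`: `0` by `H`, and the matrix element of `∑ i, b i • ψ
i`, since `hz` removes the derivatives of the exponentials. -/
theorem sum_smul_generator_eq_zero_of_tendsto {P : ι → ℝ≥0 → V →L[ℂ] V} {ψ : ι → V →L[ℂ] V}
    (hψ : ∀ i, IsGenerator (X := V) (P i) (ψ i)) {b z : ι → ℂ} (hb : ∑ i, b i = 0)
    (hz : ∑ i, b i * z i = 0)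
    (H : ∀ (x : V) (v' : h') (v : h), Tendsto (fun t : ℝ≥0 => ((t : ℝ) : ℂ)⁻¹ *
      ∑ i, b i * (Complex.exp ((t : ℝ) * z i) * inner ℂ v' ((P i t x : h →L[ℂ] h') v)))
      (𝓝[>] 0) (𝓝 0)) :
    ∑ i, b i • ψ i = 0 := by
  ext1 x
  apply Subtype.ext
  ext v
  refine ext_inner_left ℂ fun v' => ?_
  have hlim : Tendsto (fun t : ℝ≥0 => ∑ i, b i * (((t : ℝ) : ℂ)⁻¹ *
      (Complex.exp ((t : ℝ) * z i) * inner ℂ v' ((P i t x : h →L[ℂ] h') v) -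
          inner ℂ v' ((x : h →L[ℂ] h') v)))) (𝓝[>] 0)
      (𝓝 (∑ i, b i * (inner ℂ v' ((ψ i x : h →L[ℂ] h') v) +
        z i * inner ℂ v' ((x : h →L[ℂ] h') v)))) :=
    tendsto_finsetSum _ fun i _ => ((hψ i).tendsto_inner _ x v' v).const_mul (b i)
  have heq := tendsto_nhds_unique_of_eventuallyEq hlim (H x v' v) (Eventually.of_forall fun t => by
    dsimp only
    -- As `∑ i, b i = 0`, subtracting the value at time `0` from every term changes nothing and
    -- produces difference quotients.
    have h3 : ∑ i, b i * (((t : ℝ) : ℂ)⁻¹ * inner ℂ v' ((x : h →L[ℂ] h') v)) = 0 := by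
      rw [← Finset.sum_mul, hb, zero_mul]
    rw [← add_zero (∑ i, _), ← h3, ← Finset.sum_add_distrib, Finset.mul_sum]
    refine Finset.sum_congr rfl fun i _ => ?_
    ring)
  simp_rw [mul_add, ← mul_assoc, Finset.sum_add_distrib, ← Finset.sum_mul, hz] at heq
  rw [zero_mul, add_zero] at heq
  simpa [inner_sum, inner_smul_right] using heq

variable [CompleteSpace h']

namespace Proc

theorem inner_uExp_const_left (k : Proc V D D') (hb : k.InitialSpaceBounded) {r t : ℝ≥0}
    (hrt : t ≤ r) (x : V) (v' : h') (c' : D') (v : h) (c : D) :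
    inner ℂ (uExp v' (Step.const r c') : HTensor h' (NoiseFock K))
        (k.toFun t x (uExp v (Step.const t c))) =
      Complex.exp ((t : ℝ) * inner ℂ (c' : K) (c : K)) *
        inner ℂ v' ((k.assocSemigroup hb c' c t x : h →L[ℂ] h') v) := by
  rw [inner_uExp_toFun, Step.inner_const hrt,
    ← k.formL_eq_assocSemigroup hb (g' := Step.const r c') (g := Step.const t c)]
  · rfl
  · exact fun s hs => by rw [Step.const_apply, if_pos (hs.trans_le hrt)]
  · exact fun s hs => by rw [Step.const_apply, if_pos hs]

theorem inner_uExp_const_right (k : Proc V D D') (hb : k.InitialSpaceBounded) {r t : ℝ≥0}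
    (hrt : t ≤ r) (x : V) (v' : h') (c' : D') (v : h) (c : D) :
    inner ℂ (uExp v' (Step.const t c') : HTensor h' (NoiseFock K))
        (k.toFun t x (uExp v (Step.const r c))) =
      Complex.exp ((t : ℝ) * inner ℂ (c' : K) (c : K)) *
        inner ℂ v' ((k.assocSemigroup hb c' c t x : h →L[ℂ] h') v) := by
  rw [inner_uExp_toFun, Step.inner_const' hrt,
    ← k.formL_eq_assocSemigroup hb (g' := Step.const t c') (g := Step.const r c)]
  · rfl
  · exact fun s hs => by rw [Step.const_apply, if_pos hs]
  · exact fun s hs => by rw [Step.const_apply, if_pos (hs.trans_le hrt)]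

theorem IsCocycle.inner_uExp_toFun_zero {k : Proc V D D'} (hk : k.IsCocycle) (x : V) (v' : h')
    (g' : Step D') (v : h) (g : Step D) :
    inner ℂ (uExp v' g' : HTensor h' (NoiseFock K)) (k.toFun 0 x (uExp v g)) =
      Complex.exp (inner ℂ (Step.toL2 g') (Step.toL2 g)) *
        inner ℂ v' ((x : h →L[ℂ] h') v) := by
  rw [inner_uExp_toFun, hk.zero, LinearMap.id_apply]

/-- The generators of the associated semigroups depend affinely on the right index. -/
theorem IsCocycle.sum_smul_generator_eq_zero {k : Proc V D D'} (hk : k.IsCocycle)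
    (hb : k.InitialSpaceBounded) (hconj : k.HasConjugate)
    (hcont' : ∀ (x : V) (ξ' : expDomain h' D'),
      ContinuousAt (fun t => adjointVec (k.toFun t x) ξ' (hconj t x ξ')) 0)
    {c' : D'} {a : ι → ℂ} {c : ι → D} (ha : ∑ i, a i = 0) (hc : ∑ i, a i • c i = 0)
    {ψ : ι → V →L[ℂ] V} (hψ : ∀ i, IsGenerator (k.assocSemigroup hb c' (c i)) (ψ i)) :
    ∑ i, a i • ψ i = 0 := by
  have hz : ∑ i, a i * inner ℂ (c' : K) (c i : K) = 0 := by
    have h2 : ∑ i, a i • (c i : K) = 0 := by simpa using congrArg Subtype.val hc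
    simp_rw [← inner_smul_right, ← inner_sum, h2, inner_zero_right]
  refine sum_smul_generator_eq_zero_of_tendsto hψ ha hz fun x v' v => ?_
  -- The horizon `1` keeps `ξ'` independent of `t`; adaptedness makes it as good as the horizon `t`
  -- for `t ≤ 1`.
  set ξ' : expDomain h' D' := uExp v' (Step.const 1 c')
  have hadj : ∀ t (ξ : expDomain h D), inner ℂ (adjointVec (k.toFun t x) ξ' (hconj t x ξ'))
      (ξ : HTensor h (NoiseFock K)) = inner ℂ (ξ' : HTensor h' (NoiseFock K)) (k.toFun t x ξ) :=
    fun t ξ => Classical.choose_spec (hconj t x ξ') ξ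
  have hsum : ∀ s t, inner ℂ (ξ' : HTensor h' (NoiseFock K))
      (k.toFun s x (∑ i, a i • uExp v (Step.const t (c i)))) =
      ∑ i, a i * inner ℂ (ξ' : HTensor h' (NoiseFock K))
        (k.toFun s x (uExp v (Step.const t (c i)))) := by
    intro s t
    rw [map_sum, inner_sum]
    refine Finset.sum_congr rfl fun i _ => ?_
    rw [map_smul, inner_smul_right]
  have hle : ∀ᶠ t : ℝ≥0 in 𝓝[>] 0, t ≤ 1 :=
    nhdsWithin_le_nhds (eventually_le_nhds zero_lt_one)
  obtain ⟨C, hC⟩ := exists_norm_sum_uExp_const_le v a c ha hc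
  have h1 := tendsto_inv_mul_inner_of_continuousAt (hcont' x ξ') hC
  simp only [hadj, hsum] at h1
  refine (h1 ?_).congr' ?_
  -- The pairing with `θ 0`: at time `0` the process is explicit, so only exponentials of `t`
  -- remain.
  · refine (tendsto_inv_mul_sum_mul_exp ha hz (inner ℂ v' ((x : h →L[ℂ] h') v))).congr' ?_
    filter_upwards [hle] with t ht
    simp only [ξ', hk.inner_uExp_toFun_zero, Step.inner_const ht]
  · filter_upwards [hle] with t ht
    simp only [ξ', k.inner_uExp_const_left hb ht]

/-- The generators of the associated semigroups depend conjugate-affinely on the left index. -/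
theorem IsCocycle.sum_conj_smul_generator_eq_zero {k : Proc V D D'} (hk : k.IsCocycle)
    (hb : k.InitialSpaceBounded)
    (hcont : ∀ (x : V) (ξ : expDomain h D), ContinuousAt (fun t => k.toFun t x ξ) 0)
    {c : D} {a : ι → ℂ} {c' : ι → D'} (ha : ∑ i, a i = 0) (hc : ∑ i, a i • c' i = 0)
    {ψ : ι → V →L[ℂ] V} (hψ : ∀ i, IsGenerator (k.assocSemigroup hb (c' i) c) (ψ i)) :
    ∑ i, conj (a i) • ψ i = 0 := by
  have hz : ∑ i, conj (a i) * inner ℂ (c' i : K) (c : K) = 0 := by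
    have h2 : ∑ i, a i • (c' i : K) = 0 := by simpa using congrArg Subtype.val hc
    simp_rw [← inner_smul_left, ← sum_inner, h2, inner_zero_left]
  have ha' : ∑ i, conj (a i) = 0 := by rw [← map_sum, ha, map_zero]
  refine sum_smul_generator_eq_zero_of_tendsto hψ ha' hz fun x v' v => ?_
  set ξ : expDomain h D := uExp v (Step.const 1 c)
  -- Here `k_s(x) ξ` plays the role of `θ`, so the varying sum sits in the second slot and the
  -- matrix elements appear conjugated.
  have hsum : ∀ s t, inner ℂ (k.toFun s x ξ)
      ((∑ i, a i • uExp v' (Step.const t (c' i)) : expDomain h' D') :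
        HTensor h' (NoiseFock K)) =
      conj (∑ i, conj (a i) * inner ℂ
        (uExp v' (Step.const t (c' i)) : HTensor h' (NoiseFock K)) (k.toFun s x ξ)) := by
    intro s t
    rw [Submodule.coe_sum, inner_sum, map_sum]
    refine Finset.sum_congr rfl fun i _ => ?_
    rw [Submodule.coe_smul, inner_smul_right, map_mul, Complex.conj_conj, inner_conj_symm]
  have hle : ∀ᶠ t : ℝ≥0 in 𝓝[>] 0, t ≤ 1 :=
    nhdsWithin_le_nhds (eventually_le_nhds zero_lt_one)
  have hconj0 : ∀ F : ℝ≥0 → ℂ, Tendsto F (𝓝[>] 0) (𝓝 0) →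
      Tendsto (fun t => conj (F t)) (𝓝[>] 0) (𝓝 0) := by
    intro F hF
    simpa [Function.comp_def] using (Complex.continuous_conj.tendsto 0).comp hF
  obtain ⟨C, hC⟩ := exists_norm_sum_uExp_const_le v' a c' ha hc
  have h1 := tendsto_inv_mul_inner_of_continuousAt (hcont x ξ) hC
  simp only [hsum] at h1
  refine (hconj0 _ (h1 ?_)).congr' ?_
  · refine (hconj0 _ (tendsto_inv_mul_sum_mul_exp ha' hz
      (inner ℂ v' ((x : h →L[ℂ] h') v)))).congr' ?_
    filter_upwards [hle] with t ht
    simp only [ξ, hk.inner_uExp_toFun_zero, Step.inner_const' ht]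
    rw [map_mul, map_inv₀, Complex.conj_ofReal]
  · filter_upwards [hle] with t ht
    simp only [ξ, k.inner_uExp_const_right hb ht]
    rw [map_mul, map_inv₀, Complex.conj_ofReal, Complex.conj_conj]

end Proc

end Generators

/-! ### Finite range of `hatAt` and induction on the exponential domain. -/

section HatMaps

variable {K : Type*} [NormedAddCommGroup K] [InnerProductSpace ℂ K] {D : Submodule ℂ K}

theorem Step.finite_range_hatAt (g : Step D) : (Set.range (Step.hatAt g)).Finite := by
  refine Set.Finite.of_finite_image (f := Subtype.val) ?_ Subtype.val_injective.injOn
  refine ((Step.finite_range g).image hat).subset ?_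
  rintro _ ⟨_, ⟨s, rfl⟩, rfl⟩
  exact ⟨_, ⟨s, rfl⟩, rfl⟩

variable {h : Type*} [NormedAddCommGroup h] [InnerProductSpace ℂ h]

theorem expDomain_induction {p : expDomain h D → Prop} (mem : ∀ u g, p (uExp u g)) (zero : p 0)
    (add : ∀ ξ η, p ξ → p η → p (ξ + η)) (smul : ∀ (a : ℂ) ξ, p ξ → p (a • ξ))
    (ξ : expDomain h D) : p ξ := by
  have hket : ∀ (u : h) (e : NoiseFock K) (he : e ∈ Exps D), p (ketD ⟨e, he⟩ u) := by
    intro u e he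
    induction he using Submodule.span_induction with
    | mem e he =>
      obtain ⟨g, rfl⟩ := he
      exact mem u g
    | zero =>
      convert zero
      refine Subtype.ext ?_
      change ket (0 : NoiseFock K) u = 0
      rw [← zero_smul ℂ (0 : NoiseFock K), ket_smul, zero_smul]
    | add e f he hf h1 h2 =>
      convert add _ _ h1 h2
      exact Subtype.ext (ket_add e f u)
    | smul a e he h1 =>
      convert smul a _ h1
      exact Subtype.ext (ket_smul a e u)
  obtain ⟨ξ, hξ⟩ := ξ
  induction hξ using Submodule.span_induction with
  | mem ξ hξ =>
    obtain ⟨u, e, he, rfl⟩ := hξ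
    exact hket u e he
  | zero => exact zero
  | add ξ η hξ hη h1 h2 => exact add _ _ h1 h2
  | smul a ξ hξ h1 => exact smul a _ h1

end HatMaps

/-! ### Continuity, right derivatives and the integral equation. -/

section WeakSolutions

variable {K : Type*} [NormedAddCommGroup K] [InnerProductSpace ℂ K] {D D' : Submodule ℂ K}
variable {h : Type*} [NormedAddCommGroup h] [InnerProductSpace ℂ h]
variable {h' : Type*} [NormedAddCommGroup h'] [InnerProductSpace ℂ h'] [CompleteSpace h']
variable {V : Submodule ℂ (h →L[ℂ] h')}

namespace Proc

variable {k : Proc V D D'}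

theorem exists_generator [CompleteSpace V] (hk : k.IsCocycle) (hreg : k.MarkovRegular) (c' : D')
    (c : D) : ∃ ψ : V →L[ℂ] V, IsGenerator (k.assocSemigroup hreg.bounded c' c) ψ := by
  exact exists_isGenerator (X := V) (hreg.norm_continuous c' c) (hk.assocSemigroup_zero hreg.bounded c' c)
    (hk.assocSemigroup_add hreg.bounded _ _)

/-- The generators of the associated semigroups are the values at the vectors `(1, c')`, `(1, c)`
of a sesquilinear map. -/
theorem exists_sesquilinear_generator [CompleteSpace V] (hk : k.IsCocycle)
    (hconj : k.HasConjugate) (hreg : k.MarkovRegular)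
    (hcont : ∀ (x : V) (ξ : expDomain h D), ContinuousAt (fun t => k.toFun t x ξ) 0)
    (hcont' : ∀ (x : V) (ξ' : expDomain h' D'),
      ContinuousAt (fun t => adjointVec (k.toFun t x) ξ' (hconj t x ξ')) 0) :
    ∃ φ : Hat D' →ₗ⋆[ℂ] Hat D →ₗ[ℂ] (V →L[ℂ] V), ∀ (c' : D') (c : D),
      IsGenerator (k.assocSemigroup hreg.bounded c' c) (φ (Hat.mk c') (Hat.mk c)) := by
  choose G hG using exists_generator hk hreg
  exact Hat.exists_sesquilinear_isGenerator (X := V) hG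
    (fun c' a c ha hc => hk.sum_smul_generator_eq_zero hreg.bounded hconj hcont' ha hc
      fun i => hG c' (c i))
    (fun c a c' ha hc => hk.sum_conj_smul_generator_eq_zero hreg.bounded hcont ha hc
      fun i => hG (c' i) c)

/-- The endpoint `s = u` is allowed although constancy is assumed only on `[r, u[`, since the map at
time `s` sees only values before `s`. -/
theorem IsCocycle.formL_eq_mul (hk : k.IsCocycle) (hb : k.InitialSpaceBounded)
    {g' : Step D'} {g : Step D} {c' : D'} {c : D} {r u s : ℝ≥0}
    (h1 : ∀ s ∈ Set.Ico r u, (g' : ℝ≥0 → K) s = c') (h2 : ∀ s ∈ Set.Ico r u, (g : ℝ≥0 → K) s = c)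
    (hs : s ∈ Set.Icc r u) :
    k.formL hb g' g s = k.formL hb g' g r * k.assocSemigroup hb c' c (s - r) := by
  have h3 : r + (s - r) = s := add_tsub_cancel_of_le hs.1
  rw [← hk.formL_add hb (c' := c') (c := c) (r := r) (t := s - r), h3]
  · exact fun q hq hq' => h1 q ⟨hq, (h3 ▸ hq').trans_le hs.2⟩
  · exact fun q hq hq' => h2 q ⟨hq, (h3 ▸ hq').trans_le hs.2⟩

theorem exists_Ico_const (g' : Step D') (g : Step D) (r : ℝ≥0) :
    ∃ u, r < u ∧ ∀ s ∈ Set.Ico r u, (g' : ℝ≥0 → K) s = (g' : ℝ≥0 → K) r ∧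
      (g : ℝ≥0 → K) s = (g : ℝ≥0 → K) r := by
  obtain ⟨u, hu, hsub⟩ := mem_nhdsGE_iff_exists_Ico_subset.1
    ((Step.eventually_eq_right g' r).and (Step.eventually_eq_right g r))
  exact ⟨u, hu, hsub⟩

theorem exists_Ico_const_left (g' : Step D') (g : Step D) {r : ℝ≥0} (hr : 0 < r) :
    ∃ m, m < r ∧ ∀ s ∈ Set.Ico m r, (g' : ℝ≥0 → K) s = (g' : ℝ≥0 → K) m ∧
      (g : ℝ≥0 → K) s = (g : ℝ≥0 → K) m := by
  obtain ⟨d', hd'⟩ := Step.exists_eventually_eq_left g' r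
  obtain ⟨d, hd⟩ := Step.exists_eventually_eq_left g r
  obtain ⟨l, hl, hsub⟩ := (mem_nhdsLT_iff_exists_Ioo_subset' hr).1 (hd'.and hd)
  obtain ⟨m, hm, hmr⟩ := exists_between (Set.mem_Iio.1 hl)
  have hm' := hsub ⟨hm, hmr⟩
  refine ⟨m, hmr, fun s hs => ?_⟩
  have hs' := hsub ⟨hm.trans_le hs.1, hs.2⟩
  exact ⟨hs'.1.trans hm'.1.symm, hs'.2.trans hm'.2.symm⟩

/-- The maps `k^{g',g}_t` of a Markov-regular cocycle depend norm-continuously on `t`. -/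
theorem IsCocycle.continuous_formL (hk : k.IsCocycle) (hreg : k.MarkovRegular) (g' : Step D')
    (g : Step D) : Continuous (k.formL hreg.bounded g' g) := by
  have hcont : ∀ (c' : D') (c : D) (r : ℝ≥0), Continuous fun s =>
      k.formL hreg.bounded g' g r * k.assocSemigroup hreg.bounded c' c (s - r) :=
    fun c' c r => continuous_mul_comp_tsub (X := V) (hreg.norm_continuous c' c) _ r
  refine continuous_iff_continuousAt.2 fun r => continuousAt_iff_continuous_left_right.2 ⟨?_, ?_⟩
  · rcases eq_or_lt_of_le (zero_le (a := r)) with rfl | hr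
    · have : Set.Iic (0 : ℝ≥0) = {0} := by
        ext s
        simp
      rw [this]
      exact continuousWithinAt_singleton
    -- For left continuity, restart the cocycle at some `m < r` with no jump on `[m, r[`; the
    -- product formula then holds up to and including `r`.
    · obtain ⟨m, hm, hc⟩ := exists_Ico_const_left g' g hr
      have heq : ∀ s ∈ Set.Icc m r, k.formL hreg.bounded g' g s = _ := fun s hs =>
        hk.formL_eq_mul hreg.bounded (c' := ⟨_, Step.apply_mem g' m⟩)
          (c := ⟨_, Step.apply_mem g m⟩) (fun q hq => (hc q hq).1) (fun q hq => (hc q hq).2) hs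
      refine (hcont ⟨_, Step.apply_mem g' m⟩ ⟨_, Step.apply_mem g m⟩ m).continuousWithinAt
        |>.congr_of_eventuallyEq ?_ (heq r ⟨hm.le, le_rfl⟩)
      filter_upwards [Icc_mem_nhdsLE hm] with s hs using heq s hs
  · obtain ⟨u, hu, hc⟩ := exists_Ico_const g' g r
    have heq : ∀ s ∈ Set.Icc r u, k.formL hreg.bounded g' g s = _ := fun s hs =>
      hk.formL_eq_mul hreg.bounded (c' := ⟨_, Step.apply_mem g' r⟩)
        (c := ⟨_, Step.apply_mem g r⟩) (fun q hq => (hc q hq).1) (fun q hq => (hc q hq).2) hs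
    refine (hcont ⟨_, Step.apply_mem g' r⟩ ⟨_, Step.apply_mem g r⟩ r).continuousWithinAt
      |>.congr_of_eventuallyEq ?_ (heq r ⟨le_rfl, hu.le⟩)
    filter_upwards [Icc_mem_nhdsGE hu] with s hs using heq s hs

theorem IsCocycle.continuous_inner_uExp (hk : k.IsCocycle) (hreg : k.MarkovRegular) (x : V)
    (v' : h') (g' : Step D') (v : h) (g : Step D) :
    Continuous fun t : ℝ≥0 =>
      inner ℂ (uExp v' g' : HTensor h' (NoiseFock K)) (k.toFun t x (uExp v g)) := by
  simp only [inner_uExp_toFun]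
  refine continuous_const.mul ?_
  have hc : Continuous fun T : V →L[ℂ] V => inner ℂ v' ((T x : h →L[ℂ] h') v) := by fun_prop
  exact hc.comp (hk.continuous_formL hreg g' g)

theorem IsCocycle.continuous_inner (hk : k.IsCocycle) (hreg : k.MarkovRegular) (x : V)
    (ξ' : expDomain h' D') (ξ : expDomain h D) :
    Continuous fun t : ℝ≥0 => inner ℂ (ξ' : HTensor h' (NoiseFock K)) (k.toFun t x ξ) := by
  induction ξ using expDomain_induction with
  | mem v g =>
    induction ξ' using expDomain_induction with
    | mem v' g' => exact hk.continuous_inner_uExp hreg x v' g' v g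
    | zero => simpa using continuous_const
    | add ξ η h1 h2 =>
      simp only [Submodule.coe_add, inner_add_left]
      exact h1.add h2
    | smul a ξ h1 =>
      simp only [Submodule.coe_smul, inner_smul_left]
      exact continuous_const.mul h1
  | zero => simpa using continuous_const
  | add ξ η h1 h2 =>
    simp only [map_add, inner_add_right]
    exact h1.add h2
  | smul a ξ h1 =>
    simp only [map_smul, inner_smul_right]
    exact continuous_const.mul h1

theorem tendsto_sub_toNNReal_nhdsGT {r : ℝ} :
    Tendsto (fun s : ℝ => (s - r).toNNReal) (𝓝[>] r) (𝓝[>] 0) := by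
  refine tendsto_toNNReal_nhdsGT_zero.comp (tendsto_nhdsWithin_iff.2 ⟨?_, ?_⟩)
  · have h1 : Continuous fun s : ℝ => s - r := by fun_prop
    simpa using (h1.tendsto r).mono_left (nhdsWithin_le_nhds (s := Set.Ioi r))
  · filter_upwards [self_mem_nhdsWithin] with s hs using sub_pos.2 (Set.mem_Ioi.1 hs)

variable {φ : Hat D' →ₗ⋆[ℂ] Hat D →ₗ[ℂ] (V →L[ℂ] V)}

/-- The matrix elements of a Markov-regular cocycle between exponential vectors are
right-differentiable. -/
theorem IsCocycle.hasDerivWithinAt_inner_uExp (hk : k.IsCocycle) (hreg : k.MarkovRegular)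
    (hφ : ∀ (c' : D') (c : D),
      IsGenerator (k.assocSemigroup hreg.bounded c' c) (φ (Hat.mk c') (Hat.mk c)))
    (x : V) (v' : h') (g' : Step D') (v : h) (g : Step D) {r : ℝ} (hr : 0 ≤ r) :
    HasDerivWithinAt (fun s : ℝ => inner ℂ (uExp v' g' : HTensor h' (NoiseFock K))
        (k.toFun s.toNNReal x (uExp v g)))
      (inner ℂ (uExp v' g' : HTensor h' (NoiseFock K)) (k.toFun r.toNNReal
        (φ (Step.hatAt g' r.toNNReal) (Step.hatAt g r.toNNReal) x) (uExp v g)))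
      (Set.Ioi r) r := by
  rw [hasDerivWithinAt_iff_tendsto_slope' (by simp)]
  simp only [inner_uExp_toFun]
  set E := Complex.exp (inner ℂ (Step.toL2 g') (Step.toL2 g))
  set q := r.toNNReal with hq
  set c' : D' := ⟨_, Step.apply_mem g' q⟩
  set c : D := ⟨_, Step.apply_mem g q⟩
  -- This continuous functional of `T`, applied to the difference quotient of `P^{c',c}` at `0`,
  -- gives the slope of the matrix element at `r`.
  have hc : Continuous fun T : V →L[ℂ] V =>
      E * inner ℂ v' ((k.formL hreg.bounded g' g q (T x) : h →L[ℂ] h') v) := by fun_prop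
  refine (((hc.tendsto _).comp (hφ c' c)).comp (tendsto_sub_toNNReal_nhdsGT (r := r))).congr' ?_
  obtain ⟨u, hu, hcst⟩ := exists_Ico_const g' g q
  have hru : r < u := by
    rwa [← NNReal.coe_lt_coe, hq, Real.coe_toNNReal _ hr] at hu
  filter_upwards [Ioo_mem_nhdsGT hru] with s hs
  have hs0 : 0 ≤ s := hr.trans hs.1.le
  have hsub : (s - r).toNNReal = s.toNNReal - q := NNReal.eq (by
    rw [NNReal.coe_sub (Real.toNNReal_le_toNNReal hs.1.le), Real.coe_toNNReal _ hs0,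
      Real.coe_toNNReal _ hr, Real.coe_toNNReal _ (sub_nonneg.2 hs.1.le)])
  have heq := hk.formL_eq_mul hreg.bounded (c' := c') (c := c) (fun q hq => (hcst q hq).1)
    (fun q hq => (hcst q hq).2) (s := s.toNNReal)
    ⟨Real.toNNReal_le_toNNReal hs.1.le, Real.toNNReal_le_iff_le_coe.2 hs.2.le⟩
  have hform : k.form g' g s.toNNReal x = k.formL hreg.bounded g' g q
      (k.assocSemigroup hreg.bounded c' c (s - r).toNNReal x) := by
    change k.formL hreg.bounded g' g s.toNNReal x = _
    rw [heq, hsub]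
    rfl
  have hform' : k.form g' g q x = k.formL hreg.bounded g' g q x := rfl
  rw [slope_def_module, hform, hform', Function.comp_apply, Function.comp_apply,
    Real.coe_toNNReal _ (sub_nonneg.2 hs.1.le), _root_.smul_apply, map_smul, Submodule.coe_smul,
    _root_.smul_apply, inner_smul_right, _root_.sub_apply, map_sub, Submodule.coe_sub,
    _root_.sub_apply, inner_sub_right, ContinuousLinearMap.id_apply, Complex.real_smul,
    Complex.ofReal_inv]
  ring

theorem IsCocycle.intervalIntegrable_inner_uExp (hk : k.IsCocycle) (hreg : k.MarkovRegular)
    (hφ : ∀ (c' : D') (c : D),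
      IsGenerator (k.assocSemigroup hreg.bounded c' c) (φ (Hat.mk c') (Hat.mk c)))
    (x : V) (v' : h') (g' : Step D') (v : h) (g : Step D) (t : ℝ≥0) :
    IntervalIntegrable (fun s : ℝ => inner ℂ (uExp v' g' : HTensor h' (NoiseFock K))
      (k.toFun s.toNNReal (φ (Step.hatAt g' s.toNNReal) (Step.hatAt g s.toNNReal) x) (uExp v g)))
      volume 0 t := by
  have hderiv := fun {r : ℝ} (hr : 0 ≤ r) =>
    hk.hasDerivWithinAt_inner_uExp hreg hφ x v' g' v g hr
  rw [intervalIntegrable_iff, Set.uIoc_of_le (NNReal.coe_nonneg t)]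
  obtain ⟨B, hB0, hB⟩ := exists_norm_apply_le_of_continuous (X := V) (hk.continuous_formL hreg g' g) t
  -- The coefficient `φ (hatAt g' s) (hatAt g s) x` takes finitely many values, hence is bounded in
  -- `s`.
  obtain ⟨C, hC⟩ := ((Set.Finite.image2 (fun ζ' ζ => φ ζ' ζ x) (Step.finite_range_hatAt g')
    (Step.finite_range_hatAt g)).isBounded).exists_norm_le
  refine Integrable.of_bound (C := ‖Complex.exp (inner ℂ (Step.toL2 g') (Step.toL2 g))‖ *
    (‖v'‖ * (B * C * ‖v‖))) ?_ ?_
  -- Measurability comes for free: the integrand is a right derivative.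
  · refine (aestronglyMeasurable_derivWithin_Ioi (fun s : ℝ => inner ℂ
      (uExp v' g' : HTensor h' (NoiseFock K)) (k.toFun s.toNNReal x (uExp v g)))
      (volume.restrict (Set.Ioc (0 : ℝ) t))).congr ?_
    filter_upwards [ae_restrict_mem measurableSet_Ioc] with s hs
    exact (hderiv hs.1.le).derivWithin (uniqueDiffWithinAt_Ioi s)
  · filter_upwards [ae_restrict_mem measurableSet_Ioc] with s hs
    rw [inner_uExp_toFun, norm_mul]
    have hst : s.toNNReal ∈ Set.Icc 0 t := ⟨zero_le, Real.toNNReal_le_iff_le_coe.2 hs.2⟩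
    set y := φ (Step.hatAt g' s.toNNReal) (Step.hatAt g s.toNNReal) x
    have hy : ‖y‖ ≤ C := hC _ ⟨_, ⟨_, rfl⟩, _, ⟨_, rfl⟩, rfl⟩
    refine mul_le_mul_of_nonneg_left ?_ (norm_nonneg _)
    refine (norm_inner_le_norm _ _).trans (mul_le_mul_of_nonneg_left ?_ (norm_nonneg _))
    refine ((k.form g' g s.toNNReal y : h →L[ℂ] h').le_opNorm v).trans
      (mul_le_mul_of_nonneg_right ?_ (norm_nonneg _))
    exact (hB _ hst y).trans (mul_le_mul_of_nonneg_left hy hB0)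

/-- A Markov-regular cocycle is a weak solution of the quantum stochastic differential equation
whose coefficient is given by the generators of its associated semigroups. -/
theorem IsCocycle.isWeakSolution (hk : k.IsCocycle) (hreg : k.MarkovRegular)
    (hφ : ∀ (c' : D') (c : D),
      IsGenerator (k.assocSemigroup hreg.bounded c' c) (φ (Hat.mk c') (Hat.mk c))) :
    k.IsWeakSolution φ V.subtype where
  weaklyContinuous := hk.continuous_inner hreg
  integrable := hk.intervalIntegrable_inner_uExp hreg hφ
  eqn x v' g' v g t := by
    have hcont : Continuous fun s : ℝ => inner ℂ (uExp v' g' : HTensor h' (NoiseFock K))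
        (k.toFun s.toNNReal x (uExp v g)) :=
      (hk.continuous_inner_uExp hreg x v' g' v g).comp continuous_real_toNNReal
    -- Right derivatives and continuity suffice, so the jumps of `g'` and `g` need no separate
    -- treatment.
    rw [intervalIntegral.integral_eq_sub_of_hasDeriv_right hcont.continuousOn
      (fun s hs => hk.hasDerivWithinAt_inner_uExp hreg hφ x v' g' v g
        (le_of_lt (by simpa using hs.1)))
      (hk.intervalIntegrable_inner_uExp hreg hφ x v' g' v g t),
      Real.toNNReal_coe, Real.toNNReal_zero, hk.inner_uExp_toFun_zero, Step.inner_exp,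
      Submodule.subtype_apply, mul_comm (inner ℂ v' _)]

end Proc

end WeakSolutions

end QS

theorem mainTheorem4
    {K : Type*} [NormedAddCommGroup K] [InnerProductSpace ℂ K] [CompleteSpace K]
    {h : Type*} [NormedAddCommGroup h] [InnerProductSpace ℂ h] [CompleteSpace h]
    {h' : Type*} [NormedAddCommGroup h'] [InnerProductSpace ℂ h'] [CompleteSpace h']
    (V : Submodule ℂ (h →L[ℂ] h')) (hV : IsClosed (V : Set (h →L[ℂ] h')))
    (D D' : Submodule ℂ K) (hD : Dense (D : Set K)) (hD' : Dense (D' : Set K))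
    (k : QS.Proc V D D') (hcoc : k.IsCocycle) (hconj : k.HasConjugate) (hreg : k.MarkovRegular)
    (hcont : ∀ (x : V) (ξ : QS.expDomain h D), ContinuousAt (fun t => k.toFun t x ξ) 0)
    (hcont' : ∀ (x : V) (ξ' : QS.expDomain h' D'),
      ContinuousAt (fun t => QS.adjointVec (k.toFun t x) ξ' (hconj t x ξ')) 0) :
    ∃ φ : QS.Hat D' →ₗ⋆[ℂ] QS.Hat D →ₗ[ℂ] (V →L[ℂ] V),
      (∀ (c' : D') (c : D), QS.IsGenerator (k.assocSemigroup hreg.bounded c' c)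
        (φ (QS.Hat.mk c') (QS.Hat.mk c))) ∧
      k.IsWeakSolution φ V.subtype := by
  -- Completeness of `V` makes the bounded operators on it a Banach algebra, as the existence of
  -- generators requires.
  have : CompleteSpace V := hV.completeSpace_coe
  obtain ⟨φ, hφ⟩ := QS.Proc.exists_sesquilinear_generator hcoc hconj hreg hcont hcont'
  exact ⟨φ, hφ, hcoc.isWeakSolution hreg hφ⟩
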